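/- Let \(x_1,x_2,\dots\), \(\alpha_1,\alpha_2,\dots\), \(\beta_1,\beta_2,\dots\) be formal variables; all identities are in the ring of formal power series over \(\mathbb Z\) in these variables. Partitions \(\lambda=(\lambda_1\ge\cdots\ge\lambda_n\ge 0)\) with at most \(n\) parts are identified with their Young diagrams \(\{(i,j):1\le i\le n,\ 1\le j\le\lambda_i\}\); \(\lambda'\) is the transpose, and for \(\mu\subseteq\lambda\) the skew shape \(\lambda/\mu\) is the set difference of the diagrams. A marked multiset-valued tableau of a skew shape \(\nu\) is a filling \(T\) of the cells \((i,j)\in\nu\) (row \(i\), column \(j\)) such that each \(T(i,j)\) is a nonempty finite multiset \(\{a_1\le\cdots\le a_k\}\) of positive integers, in which \(a_m\) may be marked if \(m\ge2\) and \(a_{m-1}<a_m\), and such that \(\max T(i,j)\le\min T(i,j+1)\) and \(\max T(i,j)<\min T(i+1,j)\) whenever the cells involved lie in \(\nu\). Its weight is \[ \mathrm{wt}(T)=\prod_{(i,j)\in\nu}\Bigl(\prod_{a\in T(i,j)}x_a\Bigr)\,\alpha_j^{u(i,j)-1}(-\beta_i)^{m(i,j)}, \] where the inner product runs over all entries, marked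 or not, with multiplicity, and \(u(i,j)\), \(m(i,j)\) are the numbers of unmarked and marked integers in \(T(i,j)\). For sequences \(\mathbf r=(r_1,\dots,r_n)\), \(\mathbf s=(s_1,\dots,s_n)\) of positive integers and a skew shape \(\nu\) with at most \(n\) columns, let \(G_{\nu}^{\mathrm{col}(\mathbf r,\mathbf s)}(\mathbf x;\boldsymbol\alpha,\boldsymbol\beta)=\sum_T\mathrm{wt}(T)\), the formal sum over all marked multiset-valued tableaux \(T\) of shape \(\nu\) with \(r_j\le\min T(i,j)\) and \(\max T(i,j)\le s_j\) for all \((i,j)\in\nu\). Let \(X_{[r,s]}=x_r+\cdots+x_s\) (which is \(0\) if \(r>s\)), \(A_m=\alpha_1+\cdots+\alpha_m\), \(B_m=\beta_1+\cdots+\beta_m\) (with \(A_0=B_0=0\)). For finite sums \(Y\), \(W\) of variables, \(e_k[Y-W]=\sum_{a+b=k}e_a(Y)(-1)^bh_b(W)\), where \(e_a\), \(h_b\) are the elementary and complete homogeneous symmetric polynomials in the variables of \(Y\), \(W\), and \(e_k[\,\cdot\,]=0\) for \(k<0\). For \(k\in\mathbb Z\) put \(e_k[Y\ominus Z]=\sum_{a-b=k}e_a[Y]\,e_b[Z]\).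 **Theorem.** Let \(\lambda,\mu\) be partitions with at most \(n\) parts, \(\mu\subseteq\lambda\), and let \(\mathbf r,\mathbf s\) be sequences of \(n\) positive integers. Suppose that for every \(1\le i\le n-1\) with \(\mu_i<\lambda_{i+1}\) we have \[ r_i-\mu_i\le r_{i+1}-\mu_{i+1}\quad\text{and}\quad s_i-\lambda_i\le s_{i+1}-\lambda_{i+1}+1 . \] Then the sum defining \(G_{\lambda'/\mu'}^{\mathrm{col}(\mathbf r,\mathbf s)}\) converges as a formal power series, and \[ G_{\lambda'/\mu'}^{\mathrm{col}(\mathbf r,\mathbf s)}(\mathbf x;\boldsymbol\alpha,\boldsymbol\beta) = D\,\det\Bigl(e_{\lambda_i-\mu_j-i+j}\bigl[X_{[r_j,s_i]}\ominus(A_{i-1}-A_j-B_{\lambda_i}+B_{\mu_j})\bigr]\Bigr)_{i,j=1}^n, \qquad D=\prod_{i=1}^n\prod_{l=r_i}^{s_i}(1-\alpha_i x_l)^{-1}, \] where a product \(\prod_{l=r}^{s}\) with \(r>s\) equals \(1\). -/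

import Mathlib

open scoped MvPowerSeries.WithPiTopology

/-- The formal variables `x_i`, `α_i`, `β_i`. Only the indices `i ≥ 1` are used. -/
inductive GVar : Type
  | x (i : ℕ) : GVar
  | α (i : ℕ) : GVar
  | β (i : ℕ) : GVar

/-- The ring of formal power series over `ℤ` in all the variables `x_i`, `α_i`, `β_i`. The scoped
topology opened above is that of coefficientwise convergence, for the discrete topology on `ℤ`. -/
abbrev GSeries : Type := MvPowerSeries GVar ℤ

namespace GSeries

/-- The variable `x_i` as a power series. -/
noncomputable abbrev x (i : ℕ) : GSeries := MvPowerSeries.X (GVar.x i)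

/-- The variable `α_i` as a power series. -/
noncomputable abbrev α (i : ℕ) : GSeries := MvPowerSeries.X (GVar.α i)

/-- The variable `β_i` as a power series. -/
noncomputable abbrev β (i : ℕ) : GSeries := MvPowerSeries.X (GVar.β i)

end GSeries

/-! ### Shapes -/

/-- The Young diagram `{(i, j) : 1 ≤ i ≤ n, 1 ≤ j ≤ p_i}` of a sequence `p = (p_1, …, p_n)`;
the entry `p_i` is `p ⟨i - 1, _⟩`. A partition with at most `n` parts is a weakly decreasing
sequence of this kind (padded by zeros). -/
def youngCells {n : ℕ} (p : Fin n → ℕ) : Finset (ℕ × ℕ) :=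
  Finset.univ.biUnion fun i : Fin n =>
    (Finset.Icc 1 (p i)).image fun j => ((i : ℕ) + 1, j)

/-- The transpose of a set of cells. -/
def transposeCells (D : Finset (ℕ × ℕ)) : Finset (ℕ × ℕ) := D.image Prod.swap

/-! ### Marked multiset-valued tableaux -/

/-- The content of one cell of a marked multiset-valued tableau: a nonempty finite multiset
`{a_1 ≤ ⋯ ≤ a_k}` of positive integers in which `a_i` may be marked if `i ≥ 2` and `a_{i-1} < a_i`.
Only the first copy of a value that is not the minimum can be marked, so a marking is recorded by
the set `marked` of the values whose first copy is marked. -/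
@[ext] structure MarkedMultiset where
  entries : Multiset ℕ
  marked : Finset ℕ
  entries_ne : entries ≠ 0
  entries_pos : ∀ a ∈ entries, 0 < a
  marked_spec : ∀ a ∈ marked, a ∈ entries ∧ ∃ b ∈ entries, b < a

namespace MarkedMultiset

/-- The number of marked integers. -/
def numMarked (S : MarkedMultiset) : ℕ := S.marked.card

/-- The number of unmarked integers. -/
def numUnmarked (S : MarkedMultiset) : ℕ := S.entries.card - S.marked.card

/-- The smallest entry is never marked, so there is at least one unmarked integer, and marked and
unmarked integers together make up all entries. -/
theorem numUnmarked_pos (S : MarkedMultiset) :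
    0 < S.numUnmarked ∧ S.numUnmarked + S.numMarked = S.entries.card := by
  have hne : S.entries.toFinset.Nonempty := by
    rw [Multiset.toFinset_nonempty]; exact S.entries_ne
  have hss : S.marked ⊂ S.entries.toFinset := by
    refine (Finset.ssubset_iff_of_subset ?_).2 ⟨S.entries.toFinset.min' hne,
      Finset.min'_mem _ _, ?_⟩
    · intro a ha
      exact Multiset.mem_toFinset.2 (S.marked_spec a ha).1
    · intro hm
      obtain ⟨-, b, hb, hlt⟩ := S.marked_spec _ hm
      exact absurd (Finset.min'_le _ b (Multiset.mem_toFinset.2 hb)) (not_le.2 hlt)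
  have h1 := Finset.card_lt_card hss
  have h2 := Multiset.toFinset_card_le S.entries
  unfold numUnmarked numMarked
  omega

end MarkedMultiset

/-- A filling `T` of the cells `(i, j) ∈ D` (row `i`, column `j`) is a marked multiset-valued
tableau if `max T(i, j) ≤ min T(i, j + 1)` and `max T(i, j) < min T(i + 1, j)` whenever both cells
belong to `D`. -/
structure IsMMSVT {D : Finset (ℕ × ℕ)} (T : D → MarkedMultiset) : Prop where
  row : ∀ c d : D, d.1 = (c.1.1, c.1.2 + 1) →
    ∀ a ∈ (T c).entries, ∀ b ∈ (T d).entries, a ≤ b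
  col : ∀ c d : D, d.1 = (c.1.1 + 1, c.1.2) →
    ∀ a ∈ (T c).entries, ∀ b ∈ (T d).entries, a < b

/-- The column flag condition: `r_j ≤ min T(i, j)` and `max T(i, j) ≤ s_j` for all cells `(i, j)`;
the entries `r_j`, `s_j` are `r ⟨j - 1, _⟩`, `s ⟨j - 1, _⟩`. -/
def IsColFlagged {D : Finset (ℕ × ℕ)} {n : ℕ} (r s : Fin n → ℕ) (T : D → MarkedMultiset) : Prop :=
  ∀ c : D, ∀ j : Fin n, c.1.2 = (j : ℕ) + 1 → ∀ a ∈ (T c).entries, r j ≤ a ∧ a ≤ s j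

/-- The set of marked multiset-valued tableaux of shape `D` with column flags `r`, `s`. -/
def MMSVTCol (D : Finset (ℕ × ℕ)) {n : ℕ} (r s : Fin n → ℕ) : Set (D → MarkedMultiset) :=
  {T | IsMMSVT T ∧ IsColFlagged r s T}

/-- The weight `∏_{(i,j)} x^{T(i,j)} α_j^{unmarked(T(i,j)) - 1} (-β_i)^{marked(T(i,j))}`. -/
noncomputable def tableauWt {D : Finset (ℕ × ℕ)} (T : D → MarkedMultiset) : GSeries :=
  ∏ c : D, ((T c).entries.map GSeries.x).prod *
    GSeries.α c.1.2 ^ ((T c).numUnmarked - 1) * (-GSeries.β c.1.1) ^ (T c).numMarked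

/-- The column-flagged refined canonical stable Grothendieck polynomial of shape `D`: the formal
sum of the weights of all marked multiset-valued tableaux with column flags `r`, `s`. -/
noncomputable def Gcol (D : Finset (ℕ × ℕ)) {n : ℕ} (r s : Fin n → ℕ) : GSeries :=
  ∑' T : MMSVTCol D r s, tableauWt T.1

/-! ### Plethystic substitution into elementary symmetric functions -/

open Classical in
/-- `e_n(y_1, …, y_r)` for a finite multiset `{y_1, …, y_r}` of variables. -/
noncomputable def eVars (s : Multiset GVar) (n : ℕ) : GSeries :=
  MvPolynomial.aeval (fun v : s => (MvPowerSeries.X v.1 : GSeries)) (MvPolynomial.esymm s ℤ n)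

open Classical in
/-- `h_n(y_1, …, y_r)` for a finite multiset `{y_1, …, y_r}` of variables. -/
noncomputable def hVars (s : Multiset GVar) (n : ℕ) : GSeries :=
  MvPolynomial.aeval (fun v : s => (MvPowerSeries.X v.1 : GSeries)) (MvPolynomial.hsymm s ℤ n)

/-- A finite formal sum of variables with integer coefficients, such as `A_n` or `X_{[r,s]}`. -/
abbrev Alphabet : Type := GVar →₀ ℤ

namespace Alphabet

/-- The variables with positive coefficient in `Z`, with multiplicity. -/
noncomputable def posVars (Z : Alphabet) : Multiset GVar :=
  Finsupp.toMultiset (Finsupp.mapRange Int.toNat Int.toNat_zero Z)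

/-- The variables with negative coefficient in `Z`, with multiplicity. -/
noncomputable def negVars (Z : Alphabet) : Multiset GVar := posVars (-Z)

/-- `X_{[r,s]} = x_r + x_{r+1} + ⋯ + x_s`, which is `0` if `r > s`. -/
noncomputable def X (r s : ℕ) : Alphabet := ∑ l ∈ Finset.Icc r s, Finsupp.single (GVar.x l) 1

/-- `A_n = α_1 + ⋯ + α_n`. -/
noncomputable def A (n : ℕ) : Alphabet := ∑ l ∈ Finset.Icc 1 n, Finsupp.single (GVar.α l) 1

/-- `B_n = β_1 + ⋯ + β_n`. -/
noncomputable def B (n : ℕ) : Alphabet := ∑ l ∈ Finset.Icc 1 n, Finsupp.single (GVar.β l) 1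

end Alphabet

/-- The plethystic substitution `e_n[Z]` for `n ≥ 0`: if `Z = Y - W` with `Y`, `W` sums of
variables, then `e_n[Z] = ∑_{a+b=n} e_a[Y] e_b[-W]` and `e_b[-W] = (-1)^b h_b[W]`. -/
noncomputable def ePlethNat (n : ℕ) (Z : Alphabet) : GSeries :=
  ∑ p ∈ Finset.HasAntidiagonal.antidiagonal n, eVars Z.posVars p.1 * ((-1) ^ p.2 * hVars Z.negVars p.2)

/-- The plethystic substitution `e_n[Z]` for `n ∈ ℤ`, with `e_n[Z] = 0` for `n < 0`. -/
noncomputable def ePleth (n : ℤ) (Z : Alphabet) : GSeries :=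
  if 0 ≤ n then ePlethNat n.toNat Z else 0

/-- `e_n[Y ⊖ Z] = ∑_{a-b=n} e_a[Y] e_b[Z]`, where `a = n + b`. The terms are homogeneous of
degrees `a + b = n + 2b`, so the formal sum converges (it is a finite sum if `Y` is a finite sum of
distinct variables). -/
noncomputable def eOminus (n : ℤ) (Y Z : Alphabet) : GSeries :=
  ∑' b : ℕ, ePleth (n + b) Y * ePleth b Z

/-- The factor `D = ∏_{i=1}^n ∏_{l=r_i}^{s_i} (1 - α_i x_l)^{-1}`, with the inverses taken in the
ring of formal power series (each `1 - α_i x_l` has constant coefficient `1`). -/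
noncomputable def colFactor {n : ℕ} (r s : Fin n → ℕ) : GSeries :=
  ∏ i : Fin n, ∏ l ∈ Finset.Icc (r i) (s i),
    MvPowerSeries.invOfUnit (1 - GSeries.α ((i : ℕ) + 1) * GSeries.x l) 1

/-! Both sides obey the same recursion, which lowers one upper flag. Column `i` of `λ'/μ'` occupies
rows `μ_i + 1, …, λ_i`. Let `s_i = t + 1` be the largest upper flag, `i` rightmost with this
property, and write `x = x_{t+1}`. Since columns increase strictly, `t + 1` can occur in column `i`
only in its bottom cell.

If column `i + 1` is shorter, the bottom cell is a corner. Removing one copy of `t + 1` from its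
content gives `(1 - α_i x) G(λ, s) = (1 - β_{λ_i} x) G(λ, s - ε_i) + x G(λ - ε_i, s - ε_i)`, with
`ε_i` the `i`-th unit vector (`Gcol_succ`). If `λ_i = λ_{i+1}`, the flag condition forces `s_{i+1} =
t`. The right neighbour of the bottom cell then keeps its entries at most `t`, and lowering `s_i` to
`t` changes nothing (`Gcol_skewCells_update_of_blocked`).

On the determinant side only row `i` contains `λ_i` and `s_i`. Adjoining `x` to `X_{[r_j, t]}` and
one `β` or `α` to the second alphabet expands that row as needed (`det_jtMatrix_succ`,
`det_jtMatrix_succ_of_blocked`). In the blocked case the extra term repeats row `i + 1` and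
vanishes. The factor `1 - α_i x` is what `D` gains when `s_i` drops (`colFactor_update`).

Three situations end or prepare the recursion. An empty column contributes a diagonal factor that
cancels against `D`, so its flags are arbitrary (`colFactor_mul_det_congr`). If no upper flag
reaches the lower flag of some nonempty column, both sides are zero (`det_jtMatrix_eq_zero`). If `λ
= μ`, both sides are `1`. -/

/-! ### Recurrences for elementary and complete homogeneous polynomials. -/

theorem eVars_eq_esymm (s : Multiset GVar) (n : ℕ) :
    eVars s n = (s.map fun v => (MvPowerSeries.X v : GSeries)).esymm n := by
  classical
  unfold eVars
  rw [MvPolynomial.aeval_esymm_eq_multiset_esymm]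
  congr 1
  conv_rhs => rw [← Multiset.map_univ_coe s]
  rw [Multiset.map_map]
  rfl

theorem eVars_zero (s : Multiset GVar) : eVars s 0 = 1 := by
  simp [eVars_eq_esymm, Multiset.esymm]

theorem eVars_cons_succ (v : GVar) (s : Multiset GVar) (n : ℕ) :
    eVars (v ::ₘ s) (n + 1) = eVars s (n + 1) + MvPowerSeries.X v * eVars s n := by
  simp only [eVars_eq_esymm, Multiset.esymm, Multiset.map_cons, Multiset.powersetCard_cons,
    Multiset.map_add, Multiset.sum_add, Multiset.map_map, Function.comp_def, Multiset.prod_cons,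
    Multiset.sum_map_mul_left]

/-- The complete homogeneous symmetric polynomial evaluated at a finite family. -/
def completeHomog {σ R : Type*} [Fintype σ] [DecidableEq σ] [CommSemiring R] (f : σ → R) (n : ℕ) : R :=
  ∑ t : Sym σ n, (t.1.map f).prod

theorem completeHomog_equiv {σ τ R : Type*} [Fintype σ] [DecidableEq σ] [Fintype τ] [DecidableEq τ]
    [CommSemiring R] (e : τ ≃ σ) (f : σ → R) (n : ℕ) :
    completeHomog (f ∘ e) n = completeHomog f n := by
  unfold completeHomog
  refine Fintype.sum_equiv (Sym.equivCongr e) _ _ fun t => ?_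
  simp [Sym.equivCongr, Multiset.map_map, Sym.map]

/-- A multiset of size `n + 1` either contains `none`, and one copy can be removed, or it lives
entirely in `σ`. -/
theorem completeHomog_option {σ R : Type*} [Fintype σ] [DecidableEq σ] [CommSemiring R]
    (f : Option σ → R) (n : ℕ) :
    completeHomog f (n + 1) = f none * completeHomog f n + completeHomog (f ∘ some) (n + 1) := by
  unfold completeHomog
  rw [← Equiv.sum_comp (symOptionSuccEquiv (α := σ) (n := n)).symm, Fintype.sum_sum_type,
    Finset.mul_sum]
  congr 1
  · refine Finset.sum_congr rfl fun t _ => ?_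
    simp [symOptionSuccEquiv, Sym.coe_cons]
  · refine Finset.sum_congr rfl fun t _ => ?_
    simp [symOptionSuccEquiv, Multiset.map_map, Function.comp_def]

open Classical in
theorem hVars_eq_completeHomog (s : Multiset GVar) (n : ℕ) :
    hVars s n = completeHomog (fun v : s => (MvPowerSeries.X v.1 : GSeries)) n := by
  unfold hVars completeHomog MvPolynomial.hsymm
  simp [map_sum, map_multiset_prod, Multiset.map_map]

theorem hVars_zero (s : Multiset GVar) : hVars s 0 = 1 := by
  classical
  unfold hVars; simp

theorem hVars_cons_succ (v : GVar) (s : Multiset GVar) (n : ℕ) :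
    hVars (v ::ₘ s) (n + 1) = MvPowerSeries.X v * hVars (v ::ₘ s) n + hVars s (n + 1) := by
  classical
  simp only [hVars_eq_completeHomog]
  rw [← completeHomog_equiv (Multiset.consEquiv (v := v) (m := s)).symm,
    ← completeHomog_equiv (Multiset.consEquiv (v := v) (m := s)).symm _ n, completeHomog_option]
  congr 2

/-! ### Generating functions of `e_n[Z]`. -/

/-- The generating function `∑ e_n[Z] T^n`. -/
noncomputable def plethSeries (Z : Alphabet) : PowerSeries GSeries :=
  PowerSeries.mk (eVars Z.posVars) * PowerSeries.mk fun n => (-1) ^ n * hVars Z.negVars n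

theorem coeff_plethSeries (n : ℕ) (Z : Alphabet) :
    PowerSeries.coeff n (plethSeries Z) = ePlethNat n Z := by
  simp [plethSeries, PowerSeries.coeff_mul, ePlethNat]

theorem mk_eVars_cons (v : GVar) (s : Multiset GVar) :
    PowerSeries.mk (eVars (v ::ₘ s)) =
      (1 + PowerSeries.C (MvPowerSeries.X v : GSeries) * PowerSeries.X) *
        PowerSeries.mk (eVars s) := by
  ext1 n
  cases n with
  | zero => simp [add_mul, mul_assoc, eVars_zero]
  | succ n =>
    rw [add_mul, mul_assoc, mul_comm PowerSeries.X, map_add, PowerSeries.coeff_C_mul]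
    simp [PowerSeries.coeff_succ_mul_X, eVars_cons_succ]

theorem mk_hVars_cons (v : GVar) (s : Multiset GVar) :
    (1 + PowerSeries.C (MvPowerSeries.X v : GSeries) * PowerSeries.X) *
      (PowerSeries.mk fun n => (-1) ^ n * hVars (v ::ₘ s) n) =
        PowerSeries.mk fun n => (-1) ^ n * hVars s n := by
  ext1 n
  cases n with
  | zero => simp [add_mul, mul_assoc, hVars_zero]
  | succ n =>
    rw [add_mul, mul_assoc, mul_comm PowerSeries.X, map_add, PowerSeries.coeff_C_mul]
    simp only [one_mul, PowerSeries.coeff_succ_mul_X, PowerSeries.coeff_mk, hVars_cons_succ]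
    ring

theorem posVars_add_single_of_nonneg {Z : Alphabet} {v : GVar} (h : 0 ≤ Z v) :
    (Z + Finsupp.single v 1).posVars = v ::ₘ Z.posVars := by
  classical
  ext w
  by_cases hw : w = v
  · subst hw
    simp [Alphabet.posVars, Finsupp.count_toMultiset]
    omega
  · simp [Alphabet.posVars, Finsupp.count_toMultiset, hw]

theorem posVars_add_single_of_neg {Z : Alphabet} {v : GVar} (h : Z v < 0) :
    (Z + Finsupp.single v 1).posVars = Z.posVars := by
  classical
  ext w
  by_cases hw : w = v
  · subst hw
    simp [Alphabet.posVars, Finsupp.count_toMultiset]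
    omega
  · simp [Alphabet.posVars, Finsupp.count_toMultiset, Ne.symm hw]

/-- With `Z = Y - W` in reduced form, adjoining `v` either enlarges `Y` or cancels a copy of `v` in
`W`. Both multiply the series by `1 + vT`, because the series of `-W` is a product of inverses of
such factors. All later alphabet manipulations reduce to this one-variable step. -/
theorem plethSeries_add_single (Z : Alphabet) (v : GVar) :
    plethSeries (Z + Finsupp.single v 1) =
      (1 + PowerSeries.C (MvPowerSeries.X v : GSeries) * PowerSeries.X) * plethSeries Z := by
  have hneg : -Z = -(Z + Finsupp.single v 1) + Finsupp.single v 1 := by abel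
  unfold plethSeries Alphabet.negVars
  rcases le_or_gt 0 (Z v) with h | h
  · rw [posVars_add_single_of_nonneg h, mk_eVars_cons, hneg, posVars_add_single_of_neg, mul_assoc]
    simp; omega
  · rw [posVars_add_single_of_neg h, hneg, posVars_add_single_of_nonneg (by simp; omega),
      ← mk_hVars_cons v]
    ring

theorem ePleth_of_neg {n : ℤ} (h : n < 0) (Z : Alphabet) : ePleth n Z = 0 :=
  if_neg (not_le.2 h)

theorem ePleth_natCast (n : ℕ) (Z : Alphabet) : ePleth n Z = PowerSeries.coeff n (plethSeries Z) := by
  simp [ePleth, coeff_plethSeries]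

theorem ePleth_add_single (n : ℤ) (Z : Alphabet) (v : GVar) :
    ePleth n (Z + Finsupp.single v 1) = ePleth n Z + MvPowerSeries.X v * ePleth (n - 1) Z := by
  rcases lt_or_ge n 0 with h | h
  · simp [ePleth_of_neg h, ePleth_of_neg (show n - 1 < 0 by omega)]
  · lift n to ℕ using h
    cases n with
    | zero =>
      rw [ePleth_of_neg (show ((0 : ℕ) : ℤ) - 1 < 0 by omega)]
      simp only [ePleth_natCast, plethSeries_add_single, add_mul, mul_assoc]
      simp
    | succ n =>
      rw [show ((n + 1 : ℕ) : ℤ) - 1 = (n : ℕ) by push_cast; ring]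
      simp only [ePleth_natCast, plethSeries_add_single]
      rw [add_mul, mul_assoc, mul_comm PowerSeries.X, map_add, PowerSeries.coeff_C_mul,
        PowerSeries.coeff_succ_mul_X, one_mul]

theorem ePleth_zero_right (n : ℤ) : ePleth n 0 = if n = 0 then 1 else 0 := by
  rcases lt_or_ge n 0 with h | h
  · simp [ePleth_of_neg h, h.ne]
  · lift n to ℕ using h
    classical
    have hp : (0 : Alphabet).posVars = 0 := by simp [Alphabet.posVars]
    have hn : (0 : Alphabet).negVars = 0 := by simp [Alphabet.negVars, hp]
    have he : PowerSeries.mk (eVars 0) = 1 := by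
      ext1 m
      cases m with
      | zero => simp [eVars_zero]
      | succ m => simp [eVars_eq_esymm, Multiset.esymm, PowerSeries.coeff_one,
        Multiset.powersetCard_zero_right]
    have hh : (PowerSeries.mk fun n => (-1) ^ n * hVars 0 n) = 1 := by
      ext1 m
      cases m with
      | zero => simp [hVars_zero]
      | succ m =>
        have : IsEmpty (0 : Multiset GVar).ToType := ⟨fun v => (Fin.pos v.2).ne' (Multiset.count_zero _)⟩
        simp [hVars_eq_completeHomog, completeHomog, PowerSeries.coeff_one]
    simp [ePleth_natCast, plethSeries, hp, hn, he, hh, PowerSeries.coeff_one]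

theorem ePleth_zero_left (Z : Alphabet) : ePleth 0 Z = 1 := by
  simp [ePleth, ePlethNat, eVars_zero, hVars_zero]

/-! ### Alphabets that are genuine sums of variables. -/

/-- An alphabet that is a sum of `m` variables, with repetitions allowed. -/
def Alphabet.IsSumOfVars (m : ℕ) (Z : Alphabet) : Prop :=
  ∃ s : Multiset GVar, s.card = m ∧ Z = (s.map fun v => Finsupp.single v 1).sum

theorem ePleth_eq_zero_of_lt {m : ℕ} {Z : Alphabet} (hZ : Z.IsSumOfVars m) {n : ℤ} (h : m < n) :
    ePleth n Z = 0 := by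
  obtain ⟨s, rfl, rfl⟩ := hZ
  induction s using Multiset.induction_on generalizing n with
  | empty => simp at h; simp [ePleth_zero_right, h.ne']
  | cons v s ih =>
    rw [Multiset.card_cons] at h
    push_cast at h
    rw [Multiset.map_cons, Multiset.sum_cons, add_comm, ePleth_add_single, ih (by omega),
      ih (by omega)]
    simp

theorem Alphabet.IsSumOfVars.add {m k : ℕ} {Y Z : Alphabet} (hY : Y.IsSumOfVars m)
    (hZ : Z.IsSumOfVars k) : (Y + Z).IsSumOfVars (m + k) := by
  obtain ⟨s, rfl, rfl⟩ := hY
  obtain ⟨t, rfl, rfl⟩ := hZ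
  exact ⟨s + t, by simp, by simp⟩

theorem Alphabet.isSumOfVars_single (v : GVar) :
    Alphabet.IsSumOfVars 1 (Finsupp.single v 1) :=
  ⟨{v}, by simp, by simp⟩

theorem Alphabet.isSumOfVars_sum (f : ℕ → GVar) (s : Finset ℕ) :
    Alphabet.IsSumOfVars s.card (∑ l ∈ s, Finsupp.single (f l) 1) :=
  ⟨s.val.map f, by simp, by rw [Multiset.map_map]; rfl⟩

theorem Alphabet.isSumOfVars_X (r s : ℕ) : (Alphabet.X r s).IsSumOfVars (s + 1 - r) := by
  rw [← Nat.card_Icc]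
  exact Alphabet.isSumOfVars_sum GVar.x (Finset.Icc r s)

theorem Alphabet.X_eq_zero {r s : ℕ} (h : s < r) : Alphabet.X r s = 0 := by
  simp [Alphabet.X, h]

theorem Alphabet.X_succ {r s : ℕ} (h : r ≤ s + 1) :
    Alphabet.X r (s + 1) = Alphabet.X r s + Finsupp.single (GVar.x (s + 1)) 1 := by
  rw [Alphabet.X, Finset.sum_Icc_succ_top h]
  rfl

theorem Alphabet.A_succ (n : ℕ) :
    Alphabet.A (n + 1) = Alphabet.A n + Finsupp.single (GVar.α (n + 1)) 1 := by
  rw [Alphabet.A, Finset.sum_Icc_succ_top (by omega)]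
  rfl

theorem Alphabet.B_succ (n : ℕ) :
    Alphabet.B (n + 1) = Alphabet.B n + Finsupp.single (GVar.β (n + 1)) 1 := by
  rw [Alphabet.B, Finset.sum_Icc_succ_top (by omega)]
  rfl

theorem Alphabet.isSumOfVars_A_sub {m n : ℕ} (h : m ≤ n) :
    (Alphabet.A n - Alphabet.A m).IsSumOfVars (n - m) := by
  obtain ⟨k, rfl⟩ := Nat.exists_eq_add_of_le h
  induction k with
  | zero => exact ⟨0, by simp, by simp⟩
  | succ k ih =>
    have := (ih (by omega)).add (Alphabet.isSumOfVars_single (GVar.α (m + k + 1)))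
    rw [← add_assoc, Alphabet.A_succ, show m + k + 1 - m = m + k - m + 1 by omega]
    convert this using 1
    abel

theorem Alphabet.isSumOfVars_B_sub {m n : ℕ} (h : m ≤ n) :
    (Alphabet.B n - Alphabet.B m).IsSumOfVars (n - m) := by
  obtain ⟨k, rfl⟩ := Nat.exists_eq_add_of_le h
  induction k with
  | zero => exact ⟨0, by simp, by simp⟩
  | succ k ih =>
    have := (ih (by omega)).add (Alphabet.isSumOfVars_single (GVar.β (m + k + 1)))
    rw [← add_assoc, Alphabet.B_succ, show m + k + 1 - m = m + k - m + 1 by omega]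
    convert this using 1
    abel

/-! ### The series `e_n[Y ⊖ Z]`: one-variable recursions and vanishing. -/

theorem summable_eOminus {m : ℕ} {Y : Alphabet} (hY : Y.IsSumOfVars m) (n : ℤ) (Z : Alphabet) :
    Summable fun b : ℕ => ePleth (n + b) Y * ePleth b Z := by
  refine summable_of_hasFiniteSupport ((Set.finite_Iic (m - n).toNat).subset fun b hb => ?_)
  by_contra hlt
  refine hb ?_
  simp only [Set.mem_Iic] at hlt
  dsimp only
  rw [ePleth_eq_zero_of_lt hY (by omega), zero_mul]

theorem eOminus_eq_zero_of_lt {m : ℕ} {Y : Alphabet} (hY : Y.IsSumOfVars m) {n : ℤ} (h : m < n)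
    (Z : Alphabet) : eOminus n Y Z = 0 := by
  unfold eOminus
  convert tsum_zero with b
  rw [ePleth_eq_zero_of_lt hY (by omega), zero_mul]

/-- A nonzero `e_{n+b}[Y]` needs `b ≥ -n > m`, and there `e_b[Z]` vanishes. -/
theorem eOminus_eq_zero_of_add_neg {m : ℕ} {Z : Alphabet} (hZ : Z.IsSumOfVars m) {n : ℤ}
    (h : n + m < 0) (Y : Alphabet) : eOminus n Y Z = 0 := by
  unfold eOminus
  convert tsum_zero with b
  rcases lt_or_ge (n + b) 0 with hb | hb
  · rw [ePleth_of_neg hb, zero_mul]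
  · rw [ePleth_eq_zero_of_lt hZ (by omega), mul_zero]

theorem eOminus_add_single_left {m : ℕ} {Y : Alphabet} (hY : Y.IsSumOfVars m) (n : ℤ)
    (Z : Alphabet) (v : GVar) :
    eOminus n (Y + Finsupp.single v 1) Z =
      eOminus n Y Z + MvPowerSeries.X v * eOminus (n - 1) Y Z := by
  unfold eOminus
  rw [← (summable_eOminus hY (n - 1) Z).tsum_mul_left,
    ← (summable_eOminus hY n Z).tsum_add ((summable_eOminus hY (n - 1) Z).mul_left _)]
  refine tsum_congr fun b => ?_
  rw [ePleth_add_single, show n + b - 1 = n - 1 + b by ring]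
  ring

/-- Taking `v` out of `e_b` lowers `b` by one at fixed `a`, so the difference `a - b` rises to `n +
1`. -/
theorem eOminus_add_single_right {m : ℕ} {Y : Alphabet} (hY : Y.IsSumOfVars m) (n : ℤ)
    (Z : Alphabet) (v : GVar) :
    eOminus n Y (Z + Finsupp.single v 1) =
      eOminus n Y Z + MvPowerSeries.X v * eOminus (n + 1) Y Z := by
  unfold eOminus
  -- The term `b = 0` is split off because `v` can only be taken from `e_b` with `b ≥ 1`.
  rw [(summable_eOminus hY n _).tsum_eq_zero_add, (summable_eOminus hY n Z).tsum_eq_zero_add,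
    ← (summable_eOminus hY (n + 1) Z).tsum_mul_left, add_assoc,
    ← ((summable_nat_add_iff 1).2 (summable_eOminus hY n Z)).tsum_add
      ((summable_eOminus hY (n + 1) Z).mul_left _)]
  refine congrArg₂ (· + ·) (by simp only [Nat.cast_zero, ePleth_zero_left]) (tsum_congr fun b => ?_)
  rw [ePleth_add_single, show n + ((b + 1 : ℕ) : ℤ) = n + 1 + b by push_cast; ring,
    show ((b + 1 : ℕ) : ℤ) - 1 = b by push_cast; ring]
  ring

theorem eOminus_zero_zero (Z : Alphabet) : eOminus 0 0 Z = 1 := by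
  unfold eOminus
  rw [tsum_eq_single 0]
  · simp [ePleth_zero_left]
  · intro b hb
    simp [ePleth_zero_right, hb]

theorem eOminus_neg_one_zero (Y : Alphabet) : eOminus (-1) Y 0 = 0 := by
  unfold eOminus
  convert tsum_zero with b
  cases b with
  | zero => simp [ePleth_of_neg]
  | succ b => rw [ePleth_zero_right, if_neg (by omega), mul_zero]

/-- Adjoining `v` to `-v` gives the empty alphabet, and `e_{-1}[X ⊖ 0] = 0`. Hence `e_{-1}[X ⊖ (-v)]
= -v e_0[X ⊖ (-v)]`, and each new `x_l` multiplies `e_0` by `1 - v x_l`. -/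
theorem eOminus_zero_X_neg_single (r s : ℕ) (v : GVar) :
    eOminus 0 (Alphabet.X r s) (-Finsupp.single v 1) =
      ∏ l ∈ Finset.Icc r s, (1 - MvPowerSeries.X v * GSeries.x l) := by
  induction s with
  | zero =>
    rcases Nat.eq_zero_or_pos r with rfl | h
    -- The interval from `0` to `0` contains the index `0`, so this base case has one variable
    -- `x_0`; `X 1 0` serves as the empty alphabet.
    · have h0 := eOminus_add_single_left (Alphabet.isSumOfVars_X 1 0) 0
        (-Finsupp.single v 1) (GVar.x 0)
      have h1 := eOminus_add_single_right (Alphabet.isSumOfVars_X 1 0) (-1)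
        (-Finsupp.single v 1) v
      rw [neg_add_cancel, eOminus_neg_one_zero] at h1
      simp only [Alphabet.X_eq_zero (show 0 < 1 by omega), eOminus_zero_zero, zero_sub,
        neg_add_cancel, zero_add] at h0 h1
      simp only [Alphabet.X, Finset.Icc_self, Finset.sum_singleton, Finset.prod_singleton, h0]
      linear_combination (- GSeries.x 0) * h1
    · rw [Alphabet.X_eq_zero h, eOminus_zero_zero]
      simp [h]
  | succ s ih =>
    rcases le_or_gt r (s + 1) with h | h
    · rw [Alphabet.X_succ h, eOminus_add_single_left (Alphabet.isSumOfVars_X r s),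
        Finset.prod_Icc_succ_top h, ← ih]
      have h1 := eOminus_add_single_right (Alphabet.isSumOfVars_X r s) (-1)
        (-Finsupp.single v 1) v
      rw [neg_add_cancel, eOminus_neg_one_zero, neg_add_cancel] at h1
      rw [zero_sub]
      linear_combination (- GSeries.x (s + 1)) * h1
    · rw [Alphabet.X_eq_zero h, eOminus_zero_zero]
      simp [h]

/-! ### Recursions and vanishing of the Jacobi–Trudi entries. -/

/-- The entry in row `i` and column `j` (counted from `0`) of the Jacobi-Trudi matrix, where `l`,
`m` are the parts of `λ`, `μ` and `r`, `s` the flag bounds. -/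
noncomputable def jtEntry (i j l m r s : ℕ) : GSeries :=
  eOminus ((l : ℤ) - m - ((i : ℤ) + 1) + ((j : ℤ) + 1)) (Alphabet.X r s)
    (Alphabet.A i - Alphabet.A (j + 1) - Alphabet.B l + Alphabet.B m)

/-- Passing from `l + 1` to `l` adjoins `β_{l+1}` to the second alphabet and lowers the index by
one. This absorbs the term `e_{k-1}` produced by the new `x`, where `k` is the index of the
left-hand entry, at the cost of the factor `1 - βx`. -/
theorem jtEntry_succ (i j l m : ℕ) {r s : ℕ} (h : r ≤ s + 1) :
    jtEntry i j (l + 1) m r (s + 1) =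
      (1 - GSeries.β (l + 1) * GSeries.x (s + 1)) * jtEntry i j (l + 1) m r s +
        GSeries.x (s + 1) * jtEntry i j l m r s := by
  have hX := Alphabet.isSumOfVars_X r s
  have hZ : Alphabet.A i - Alphabet.A (j + 1) - Alphabet.B l + Alphabet.B m =
      Alphabet.A i - Alphabet.A (j + 1) - Alphabet.B (l + 1) + Alphabet.B m +
        Finsupp.single (GVar.β (l + 1)) 1 := by
    rw [Alphabet.B_succ]; abel
  unfold jtEntry
  rw [Alphabet.X_succ h, eOminus_add_single_left hX, hZ, eOminus_add_single_right hX]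
  push_cast
  ring_nf

/-- The same mechanism with `α_{i+1}`: moving to the next row also lowers the index by one. -/
theorem jtEntry_succ_row (i j l m : ℕ) {r s : ℕ} (h : r ≤ s + 1) :
    jtEntry i j l m r (s + 1) =
      (1 - GSeries.α (i + 1) * GSeries.x (s + 1)) * jtEntry i j l m r s +
        GSeries.x (s + 1) * jtEntry (i + 1) j l m r s := by
  have hX := Alphabet.isSumOfVars_X r s
  have hZ : Alphabet.A (i + 1) - Alphabet.A (j + 1) - Alphabet.B l + Alphabet.B m =
      Alphabet.A i - Alphabet.A (j + 1) - Alphabet.B l + Alphabet.B m +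
        Finsupp.single (GVar.α (i + 1)) 1 := by
    rw [Alphabet.A_succ i]; abel
  unfold jtEntry
  rw [Alphabet.X_succ h, eOminus_add_single_left hX, hZ, eOminus_add_single_right hX]
  push_cast
  ring_nf

/-- The second alphabet is a sum of `(i - j - 1) + (m - l)` variables, exactly one too few for the
index `-(i - j) - (m - l)`. -/
theorem jtEntry_eq_zero_of_le {i j l m : ℕ} (hij : j < i) (h : l ≤ m) (r s : ℕ) :
    jtEntry i j l m r s = 0 := by
  have hZ := (Alphabet.isSumOfVars_A_sub (show j + 1 ≤ i by omega)).add
    (Alphabet.isSumOfVars_B_sub h)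
  refine eOminus_eq_zero_of_add_neg (m := i - (j + 1) + (m - l)) ?_ (by omega) _
  convert hZ using 1
  abel

theorem jtEntry_eq_zero_of_lt {i j l m r s : ℕ}
    (h : ((s + 1 - r : ℕ) : ℤ) < (l : ℤ) - m - i + j) : jtEntry i j l m r s = 0 :=
  eOminus_eq_zero_of_lt (Alphabet.isSumOfVars_X r s) (by omega) _

theorem jtEntry_self (i m r s : ℕ) :
    jtEntry i i m m r s = ∏ l ∈ Finset.Icc r s, (1 - GSeries.α (i + 1) * GSeries.x l) := by
  rw [← eOminus_zero_X_neg_single, jtEntry, Alphabet.A_succ]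
  congr 1 <;> abel

/-! ### Determinants with zero patterns. -/

namespace Matrix

variable {ι R : Type*} [Fintype ι] [DecidableEq ι] [CommRing R]

/-- By pigeonhole every permutation sends some column of `C` to a row outside `S`, so each term of
the expansion has a zero factor. -/
theorem det_eq_zero_of_card_lt (M : Matrix ι ι R) (C S : Finset ι) (hcard : S.card < C.card)
    (h : ∀ j ∈ C, ∀ i ∉ S, M i j = 0) : M.det = 0 := by
  rw [det_apply]
  refine Finset.sum_eq_zero fun σ _ => ?_
  have : ∃ j ∈ C, σ j ∉ S := by
    by_contra! hc
    have := Finset.card_le_card_of_injOn σ hc σ.injective.injOn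
    omega
  obtain ⟨j, hj, hσ⟩ := this
  rw [Finset.prod_eq_zero (f := fun k => M (σ k) k) (Finset.mem_univ j) (h j hj _ hσ), smul_zero]

theorem det_eq_add_of_row {M M₁ M₂ : Matrix ι ι R} (i : ι) (a b : R)
    (h₁ : ∀ k, k ≠ i → M k = M₁ k) (h₂ : ∀ k, k ≠ i → M k = M₂ k)
    (hi : ∀ j, M i j = a * M₁ i j + b * M₂ i j) : M.det = a * M₁.det + b * M₂.det := by
  have e₁ : M₁ = M.updateRow i (M₁ i) := by
    ext k l
    by_cases hk : k = i
    · subst hk; simp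
    · simp [hk, h₁ k hk]
  have e₂ : M₂ = M.updateRow i (M₂ i) := by
    ext k l
    by_cases hk : k = i
    · subst hk; simp
    · simp [hk, h₂ k hk]
  have e : M = M.updateRow i (a • M₁ i + b • M₂ i) := by
    ext k l
    by_cases hk : k = i
    · subst hk; simp [hi]
    · simp [hk]
  conv_lhs => rw [e]
  rw [det_updateRow_add, det_updateRow_smul, det_updateRow_smul, ← e₁, ← e₂]

/-- The matrix is block upper triangular with `{j}` as a diagonal block. Row and column `j` are
replaced by those of the identity, not deleted, so the index type stays the same and the second
factor visibly ignores them. -/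
theorem det_eq_mul_of_isolated {n : ℕ} (M : Matrix (Fin n) (Fin n) R) (j : Fin n)
    (h₁ : ∀ i k, j ≤ i → k < j → M i k = 0) (h₂ : ∀ i k, j < i → k ≤ j → M i k = 0) :
    M.det = M j j * (Matrix.of fun i k : Fin n =>
      if i = j ∨ k = j then (if i = k then 1 else 0) else M i k).det := by
  rw [det_apply, det_apply, Finset.mul_sum]
  refine Finset.sum_congr rfl fun σ _ => ?_
  rw [mul_smul_comm]
  congr 1
  by_cases hσ : σ j = j
  · rw [← Finset.mul_prod_erase _ _ (Finset.mem_univ j),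
      ← Finset.mul_prod_erase _ (fun k => Matrix.of _ _ _) (Finset.mem_univ j)]
    simp only [hσ, of_apply, true_or, if_true, one_mul]
    congr 1
    refine Finset.prod_congr rfl fun k hk => ?_
    have hk : k ≠ j := Finset.ne_of_mem_erase hk
    have : σ k ≠ j := fun h => hk (σ.injective (h.trans hσ.symm))
    simp [hk, this]
  · rw [Finset.prod_eq_zero (f := fun k => Matrix.of _ _ _) (Finset.mem_univ j) (by simp [hσ]),
      mul_zero]
    rcases lt_or_gt_of_ne hσ with h | h
    -- The `j + 1` indices up to `j` cannot inject into the `j` indices below `j`.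
    · have : ∃ k ∈ Finset.Iic j, σ k ∉ Finset.Iio j := by
        by_contra! hc
        have := Finset.card_le_card_of_injOn σ hc σ.injective.injOn
        simp at this
      obtain ⟨k, hk, hk'⟩ := this
      simp only [Finset.mem_Iic, Finset.mem_Iio, not_lt] at hk hk'
      have hkj : k ≠ j := by rintro rfl; exact absurd h (not_lt.2 hk')
      exact Finset.prod_eq_zero (Finset.mem_univ k) (h₁ _ _ hk' (lt_of_le_of_ne hk hkj))
    · exact Finset.prod_eq_zero (Finset.mem_univ j) (h₂ _ _ h le_rfl)

end Matrix

/-! ### The Jacobi–Trudi determinant. -/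

section JacobiTrudi

/-- The Jacobi-Trudi matrix. -/
noncomputable def jtMatrix {n : ℕ} (lam mu r s : Fin n → ℕ) : Matrix (Fin n) (Fin n) GSeries :=
  Matrix.of fun i j => jtEntry i j (lam i) (mu j) (r j) (s i)

variable {n : ℕ} {lam mu r s : Fin n → ℕ}

theorem jtMatrix_eq_zero (hlam : Antitone lam) (hmu : Antitone mu) {t t' i j : Fin n}
    (hjt : j ≤ t) (hti : t' ≤ i) (hji : j < i) (h : lam t' ≤ mu t) :
    jtMatrix lam mu r s i j = 0 :=
  jtEntry_eq_zero_of_le hji ((hlam hti).trans (h.trans (hmu hjt))) _ _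

/-- The columns linked to `j` from the right by `μ_t < λ_{t+1}` have all their nonzero entries in
the same set of rows without row `j`: one row too few. -/
theorem det_jtMatrix_eq_zero (hlam : Antitone lam) (hmu : Antitone mu)
    (hflag : ∀ i j : Fin n, (i : ℕ) + 1 = (j : ℕ) → mu i < lam j →
      (r i : ℤ) - mu i ≤ (r j : ℤ) - mu j)
    {j : Fin n} (hj : mu j < lam j) (hrs : ∀ i, s i < r j) : (jtMatrix lam mu r s).det = 0 := by
  classical
  -- An unbroken run of columns starting at `j`; along it the condition on the lower flags chains to
  -- `r_j - μ_j ≤ r_k - μ_k`.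
  let C : Finset (Fin n) := Finset.univ.filter fun k => j ≤ k ∧
    ∀ t t' : Fin n, (t : ℕ) + 1 = (t' : ℕ) → j ≤ t → t < k → mu t < lam t'
  have hjC : j ∈ C := by
    simp only [C, Finset.mem_filter, Finset.mem_univ, true_and, le_refl]
    intro t t' _ h1 h2
    exact absurd h1 (not_le.2 h2)
  have hCr : ∀ d : ℕ, ∀ k ∈ C, (k : ℕ) = j + d → (r j : ℤ) - mu j ≤ (r k : ℤ) - mu k := by
    intro d
    induction d with
    | zero =>
      intro k _ hk
      rw [show k = j from Fin.ext hk]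
    | succ d ih =>
      intro k hk hkd
      obtain ⟨-, -, hk⟩ := Finset.mem_filter.1 hk
      have hlt : (j : ℕ) + d < n := by have := k.2; omega
      refine (ih ⟨j + d, hlt⟩ ?_ rfl).trans (hflag _ _ (by simp [hkd]; omega)
        (hk _ _ (by simp [hkd]; omega) (by simp [Fin.le_def]) (by simp [Fin.lt_def, hkd])))
      refine Finset.mem_filter.2 ⟨Finset.mem_univ _, by simp [Fin.le_def], fun t t' h h1 h2 => ?_⟩
      refine hk t t' h h1 (h2.trans (by simp [Fin.lt_def, hkd]))
  refine Matrix.det_eq_zero_of_card_lt _ C (C.erase j) (Finset.card_erase_lt_of_mem hjC) ?_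
  intro k hk i hi
  have hjk : j ≤ k := (Finset.mem_filter.1 hk).2.1
  rcases le_or_gt i j with hij | hij
  -- For rows `i ≤ j` the index exceeds the number of `x`-variables: `s_i + 1 - r_k ≤ r_j - r_k ≤
  -- μ_j - μ_k < λ_i - μ_k`, and `i ≤ k`. If there are no variables, the index is still positive.
  · refine jtEntry_eq_zero_of_lt ?_
    have h1 := hCr (k - j) k hk (by have : (j : ℕ) ≤ k := hjk; omega)
    have h2 : lam j ≤ lam i := hlam hij
    have h3 : mu k ≤ mu j := hmu hjk
    have h4 := hrs i
    have h5 : (i : ℕ) ≤ k := hij.trans hjk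
    omega
  · have hiC : i ∉ C := fun h => hi (Finset.mem_erase.2 ⟨hij.ne', h⟩)
    -- A row below `j` outside `C` lies beyond a break `λ_{t+1} ≤ μ_t`, while column `k` lies before
    -- it.
    simp only [C, Finset.mem_filter, Finset.mem_univ, true_and, not_and, not_forall, not_lt] at hiC
    obtain ⟨t, t', htt, h1, h2, h3⟩ := hiC hij.le
    have hkt : k ≤ t := by
      by_contra! hkt
      exact absurd ((Finset.mem_filter.1 hk).2.2 t t' htt h1 hkt) (not_lt.2 h3)
    exact jtMatrix_eq_zero hlam hmu hkt (by rw [Fin.le_def]; rw [Fin.lt_def] at h2; omega)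
      (hkt.trans_lt h2) h3

/-- When `λ_j = μ_j`, index `j` is isolated in the matrix. Its diagonal entry `∏ (1 - α_j x_l)`
cancels the `j`-th factor of `D`, which removes all dependence on `r_j` and `s_j`. -/
theorem colFactor_mul_det_congr (hlam : Antitone lam) (hmu : Antitone mu) {r' s' : Fin n → ℕ}
    {j : Fin n} (hj : lam j = mu j) (hr' : ∀ i, i ≠ j → r' i = r i)
    (hs' : ∀ i, i ≠ j → s' i = s i) :
    colFactor r s * (jtMatrix lam mu r s).det = colFactor r' s' * (jtMatrix lam mu r' s').det := by
  have key : ∀ r s : Fin n → ℕ, colFactor r s * (jtMatrix lam mu r s).det =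
      (∏ i ∈ Finset.univ.erase j, ∏ l ∈ Finset.Icc (r i) (s i),
        MvPowerSeries.invOfUnit (1 - GSeries.α ((i : ℕ) + 1) * GSeries.x l) 1) *
      (Matrix.of fun i k : Fin n => if i = j ∨ k = j then (if i = k then 1 else 0)
        else jtMatrix lam mu r s i k).det := by
    intro r s
    rw [Matrix.det_eq_mul_of_isolated _ j
      (fun i k hi hk => jtMatrix_eq_zero hlam hmu hk.le hi (hk.trans_le hi) hj.le)
      (fun i k hi hk => jtMatrix_eq_zero hlam hmu hk hi.le (hk.trans_lt hi) hj.le)]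
    have : jtMatrix lam mu r s j j = ∏ l ∈ Finset.Icc (r j) (s j),
        (1 - GSeries.α (j + 1) * GSeries.x l) := by
      rw [jtMatrix, Matrix.of_apply, hj, jtEntry_self]
    rw [this, colFactor, ← Finset.mul_prod_erase _ _ (Finset.mem_univ j)]
    have hcancel : (∏ l ∈ Finset.Icc (r j) (s j),
        MvPowerSeries.invOfUnit (1 - GSeries.α ((j : ℕ) + 1) * GSeries.x l) 1) *
        (∏ l ∈ Finset.Icc (r j) (s j), (1 - GSeries.α (j + 1) * GSeries.x l)) = 1 := by
      rw [← Finset.prod_mul_distrib]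
      refine Finset.prod_eq_one fun l _ => ?_
      rw [mul_comm, MvPowerSeries.mul_invOfUnit _ _ (by simp)]
    linear_combination (∏ i ∈ Finset.univ.erase j, ∏ l ∈ Finset.Icc (r i) (s i),
        MvPowerSeries.invOfUnit (1 - GSeries.α ((i : ℕ) + 1) * GSeries.x l) 1) *
      (Matrix.of fun i k : Fin n => if i = j ∨ k = j then (if i = k then 1 else 0)
        else jtMatrix lam mu r s i k).det * hcancel
  rw [key, key]
  refine congrArg₂ (· * ·) ?_ (congrArg Matrix.det ?_)
  · refine Finset.prod_congr rfl fun i hi => ?_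
    have hi := Finset.ne_of_mem_erase hi
    rw [hr' i hi, hs' i hi]
  · ext1 i k
    by_cases h : i = j ∨ k = j
    · simp [h]
    · simp only [Matrix.of_apply, if_neg h]
      rw [not_or] at h
      simp [jtMatrix, hr' k h.2, hs' i h.1]

theorem colFactor_mul_det_of_eq (hlam : Antitone lam) :
    colFactor r s * (jtMatrix lam lam r s).det = 1 := by
  rw [Matrix.det_of_isUpperTriangular, colFactor, ← Finset.prod_mul_distrib]
  · refine Finset.prod_eq_one fun i _ => ?_
    rw [jtMatrix, Matrix.of_apply, jtEntry_self, ← Finset.prod_mul_distrib]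
    refine Finset.prod_eq_one fun l _ => ?_
    rw [mul_comm, MvPowerSeries.mul_invOfUnit _ _ (by simp)]
  · intro i j hij
    exact jtMatrix_eq_zero hlam hlam le_rfl le_rfl hij (hlam hij.le)

theorem colFactor_update {i : Fin n} {s' : Fin n → ℕ} {t : ℕ} (hi : s i = t + 1) (hi' : s' i = t)
    (hs' : ∀ k, k ≠ i → s' k = s k) (hr : r i ≤ t + 1) :
    (1 - GSeries.α (i + 1) * GSeries.x (t + 1)) * colFactor r s = colFactor r s' := by
  rw [colFactor, colFactor, ← Finset.mul_prod_erase _ _ (Finset.mem_univ i),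
    ← Finset.mul_prod_erase _ _ (Finset.mem_univ i), hi, hi', Finset.prod_Icc_succ_top hr]
  have hc := MvPowerSeries.mul_invOfUnit
    (1 - GSeries.α ((i : ℕ) + 1) * GSeries.x (t + 1) : GSeries) 1 (by simp)
  have : ∀ k ∈ Finset.univ.erase i, ∏ l ∈ Finset.Icc (r k) (s' k),
      MvPowerSeries.invOfUnit (1 - GSeries.α ((k : ℕ) + 1) * GSeries.x l) 1 =
      ∏ l ∈ Finset.Icc (r k) (s k),
      MvPowerSeries.invOfUnit (1 - GSeries.α ((k : ℕ) + 1) * GSeries.x l) 1 := fun k hk => by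
    rw [hs' k (Finset.ne_of_mem_erase hk)]
  rw [Finset.prod_congr rfl this]
  linear_combination (∏ l ∈ Finset.Icc (r i) t,
      MvPowerSeries.invOfUnit (1 - GSeries.α ((i : ℕ) + 1) * GSeries.x l) 1) *
    (∏ k ∈ Finset.univ.erase i, ∏ l ∈ Finset.Icc (r k) (s k),
      MvPowerSeries.invOfUnit (1 - GSeries.α ((k : ℕ) + 1) * GSeries.x l) 1) * hc

theorem det_jtMatrix_succ {i : Fin n} {l t : ℕ} (hl : lam i = l + 1) (ht : s i = t + 1)
    (hr : ∀ j, r j ≤ t + 1) :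
    (jtMatrix lam mu r s).det =
      (1 - GSeries.β (l + 1) * GSeries.x (t + 1)) *
        (jtMatrix lam mu r (Function.update s i t)).det +
      GSeries.x (t + 1) *
        (jtMatrix (Function.update lam i l) mu r (Function.update s i t)).det := by
  refine Matrix.det_eq_add_of_row i _ _ (fun k hk => ?_) (fun k hk => ?_) fun j => ?_
  · ext1 j; simp [jtMatrix, hk]
  · ext1 j; simp [jtMatrix, hk]
  · simp [jtMatrix, hl, ht, jtEntry_succ _ _ _ _ (hr j)]

/-- With equal parts and `s_{i'} = t`, the second term in the expansion of row `i` is a multiple of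
row `i'`, hence does not contribute. -/
theorem det_jtMatrix_succ_of_blocked {i i' : Fin n} {t : ℕ} (hii : (i : ℕ) + 1 = i')
    (hlam : lam i = lam i') (ht : s i = t + 1) (ht' : s i' = t) (hr : ∀ j, r j ≤ t + 1) :
    (jtMatrix lam mu r s).det =
      (1 - GSeries.α (i + 1) * GSeries.x (t + 1)) *
        (jtMatrix lam mu r (Function.update s i t)).det := by
  have hne : i' ≠ i := by rintro rfl; omega
  have h := Matrix.det_eq_add_of_row (M := jtMatrix lam mu r s)
    (M₁ := jtMatrix lam mu r (Function.update s i t))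
    (M₂ := (jtMatrix lam mu r s).updateRow i (jtMatrix lam mu r s i')) i
    (1 - GSeries.α (i + 1) * GSeries.x (t + 1)) (GSeries.x (t + 1))
    (fun k hk => by ext1 j; simp [jtMatrix, hk]) (fun k hk => by simp [hk])
    (fun j => by simp [jtMatrix, hlam, ht, ht', ← hii, jtEntry_succ_row _ _ _ _ (hr j)])
  have h0 : ((jtMatrix lam mu r s).updateRow i (jtMatrix lam mu r s i')).det = 0 :=
    Matrix.det_zero_of_row_eq hne.symm (by
      rw [Matrix.updateRow_self, Matrix.updateRow_ne hne])
  rw [h, h0, mul_zero, add_zero]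

end JacobiTrudi

/-! ### Convergence of the sums over contents and tableaux. -/

/-- The contribution of a cell in row `i` and column `j` with content `S` to the weight. -/
noncomputable def cellWt (i j : ℕ) (S : MarkedMultiset) : GSeries :=
  (S.entries.map GSeries.x).prod * GSeries.α j ^ (S.numUnmarked - 1) *
    (-GSeries.β i) ^ S.numMarked

/-- The `x`-part alone has degree equal to the number of entries. With entries bounded by a flag,
only finitely many contents have order at most a given `k`, which gives summability. -/
theorem card_le_order_cellWt (i j : ℕ) (S : MarkedMultiset) :
    (S.entries.card : ℕ∞) ≤ (cellWt i j S).order := by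
  have h : ∀ m : Multiset ℕ, (m.card : ℕ∞) ≤ ((m.map GSeries.x).prod : GSeries).order := by
    intro m
    induction m using Multiset.induction_on with
    | empty => simp
    | cons a m ih =>
      rw [Multiset.map_cons, Multiset.prod_cons, Multiset.card_cons, add_comm]
      push_cast
      refine le_trans (add_le_add ?_ ih) MvPowerSeries.le_order_mul
      rw [show GSeries.x a = MvPowerSeries.monomial (Finsupp.single (GVar.x a) 1) 1 from rfl,
        MvPowerSeries.order_monomial_of_ne_zero one_ne_zero]
      simp
  unfold cellWt
  rw [mul_assoc]
  exact (h _).trans (le_self_add.trans MvPowerSeries.le_order_mul)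

theorem MarkedMultiset.finite_setOf_card_le (N k : ℕ) :
    {S : MarkedMultiset | S.entries.card ≤ k ∧ ∀ a ∈ S.entries, a ≤ N}.Finite := by
  have hf : {m : Multiset ℕ | m.card ≤ k ∧ ∀ a ∈ m, a ≤ N}.Finite := by
    refine (Multiset.finite_toSet (Multiset.powerset (k • (Finset.range (N + 1)).val))).subset ?_
    rintro m ⟨h1, h2⟩
    simp only [Set.mem_ofPred_eq, Multiset.mem_powerset]
    refine Multiset.le_iff_count.2 fun a => ?_
    rw [Multiset.count_nsmul]
    by_cases ha : a ∈ m
    · have : Multiset.count a (Finset.range (N + 1)).val = 1 :=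
        Multiset.count_eq_one_of_mem (Finset.nodup _) (Finset.mem_range_succ_iff.2 (h2 a ha))
      rw [this]
      simpa using (Multiset.count_le_card a m).trans h1
    · simp [Multiset.count_eq_zero_of_notMem ha]
  refine Set.Finite.of_finite_image (f := fun S => (S.entries, S.marked)) ?_ ?_
  · refine (hf.prod (Finset.finite_toSet (Finset.range (N + 1)).powerset)).subset ?_
    rintro _ ⟨S, hS, rfl⟩
    refine ⟨hS, ?_⟩
    simp only [Finset.coe_powerset, Set.mem_preimage, Set.mem_powerset_iff]
    intro a ha
    simpa [Nat.lt_succ_iff] using hS.2 a (S.marked_spec a ha).1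
  · intro S _ T _ h
    exact MarkedMultiset.ext (congrArg Prod.fst h) (congrArg Prod.snd h)

theorem GSeries.summable_of_finite {ι : Type*} {f : ι → GSeries}
    (h : ∀ k : ℕ, {i | (f i).order ≤ k}.Finite) : Summable f := by
  rw [MvPowerSeries.WithPiTopology.summable_iff_summable_coeff]
  intro d
  refine summable_of_hasFiniteSupport ((h d.degree).subset fun i hi => ?_)
  exact MvPowerSeries.order_le hi

theorem summable_cellWt (i j N : ℕ) (A : Set MarkedMultiset)
    (hA : ∀ S ∈ A, ∀ a ∈ S.entries, a ≤ N) : Summable fun S : A => cellWt i j S.1 := by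
  refine GSeries.summable_of_finite fun k => ?_
  refine Set.Finite.of_finite_image (f := Subtype.val) ?_ Subtype.val_injective.injOn
  refine (MarkedMultiset.finite_setOf_card_le N k).subset ?_
  rintro _ ⟨S, hS, rfl⟩
  exact ⟨by exact_mod_cast (card_le_order_cellWt i j S.1).trans hS, hA _ S.2⟩

theorem tableauWt_eq_prod_cellWt {D : Finset (ℕ × ℕ)} (T : D → MarkedMultiset) :
    tableauWt T = ∏ c : D, cellWt c.1.1 c.1.2 (T c) := rfl

theorem summable_tableauWt {D : Finset (ℕ × ℕ)} (N : ℕ) (A : Set (D → MarkedMultiset))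
    (hA : ∀ T ∈ A, ∀ c, ∀ a ∈ (T c).entries, a ≤ N) : Summable fun T : A => tableauWt T.1 := by
  classical
  refine GSeries.summable_of_finite fun k => ?_
  refine Set.Finite.of_finite_image (f := Subtype.val) ?_ Subtype.val_injective.injOn
  refine (Set.Finite.pi' fun _ : D => MarkedMultiset.finite_setOf_card_le N k).subset ?_
  rintro _ ⟨T, hT, rfl⟩ c
  refine ⟨?_, hA _ T.2 c⟩
  have h1 : (cellWt c.1.1 c.1.2 (T.1 c)).order ≤ (tableauWt T.1).order := by
    rw [tableauWt_eq_prod_cellWt, ← Finset.mul_prod_erase _ _ (Finset.mem_univ c)]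
    exact le_self_add.trans MvPowerSeries.le_order_mul
  exact_mod_cast ((card_le_order_cellWt _ _ _).trans h1).trans hT

/-! ### Contents of one cell, sorted by the largest allowed value. -/

namespace MarkedMultiset

/-- Adjoin an unmarked copy of `v`. -/
def addUnmarked (S : MarkedMultiset) (v : ℕ) (hv : 0 < v) : MarkedMultiset where
  entries := v ::ₘ S.entries
  marked := S.marked
  entries_ne := Multiset.cons_ne_zero
  entries_pos := by
    intro a ha
    rcases Multiset.mem_cons.1 ha with rfl | ha
    exacts [hv, S.entries_pos a ha]
  marked_spec := fun a ha =>
    let ⟨h, b, hb, hba⟩ := S.marked_spec a ha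
    ⟨Multiset.mem_cons_of_mem h, b, Multiset.mem_cons_of_mem hb, hba⟩

/-- Adjoin a marked copy of a value `v` that is larger than some entry. -/
def addMarked (S : MarkedMultiset) (v : ℕ) (hv : ∃ b ∈ S.entries, b < v) : MarkedMultiset where
  entries := v ::ₘ S.entries
  marked := insert v S.marked
  entries_ne := Multiset.cons_ne_zero
  entries_pos := by
    intro a ha
    rcases Multiset.mem_cons.1 ha with rfl | ha
    · obtain ⟨b, -, hb⟩ := hv; omega
    · exact S.entries_pos a ha
  marked_spec := by
    intro a ha
    rcases Finset.mem_insert.1 ha with rfl | ha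
    · obtain ⟨b, hb, hba⟩ := hv
      exact ⟨Multiset.mem_cons_self _ _, b, Multiset.mem_cons_of_mem hb, hba⟩
    · obtain ⟨h, b, hb, hba⟩ := S.marked_spec a ha
      exact ⟨Multiset.mem_cons_of_mem h, b, Multiset.mem_cons_of_mem hb, hba⟩

/-- The content with the single entry `v`. -/
def single (v : ℕ) (hv : 0 < v) : MarkedMultiset where
  entries := {v}
  marked := ∅
  entries_ne := Multiset.singleton_ne_zero v
  entries_pos := by simpa using hv
  marked_spec := by simp

/-- The contents whose entries are at most `w` and satisfy `P`. -/
def bounded (P : ℕ → Prop) (w : ℕ) : Set MarkedMultiset := {S | ∀ b ∈ S.entries, P b ∧ b ≤ w}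

theorem exists_mem_lt {P : ℕ → Prop} {t : ℕ} {S : MarkedMultiset} (hS : S ∈ bounded P t) :
    ∃ b ∈ S.entries, b < t + 1 := by
  obtain ⟨b, hb⟩ := Multiset.exists_mem_of_ne_zero S.entries_ne
  exact ⟨b, hb, Nat.lt_succ_of_le (hS b hb).2⟩

theorem notMem_of_bounded {P : ℕ → Prop} {t : ℕ} {S : MarkedMultiset} (hS : S ∈ bounded P t) :
    t + 1 ∉ S.entries := fun h => by have := (hS _ h).2; omega

theorem notMem_marked_of_bounded {P : ℕ → Prop} {t : ℕ} {S : MarkedMultiset}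
    (hS : S ∈ bounded P t) : t + 1 ∉ S.marked := fun h =>
  notMem_of_bounded hS (S.marked_spec _ h).1

/-- A content with entries at most `t + 1` has no entry `t + 1`, or arises by adjoining `t + 1`
to a smaller content, or has `t + 1` as its only entry. -/
def boundedSuccMap (P : ℕ → Prop) (t : ℕ) (hP : P (t + 1)) :
    (bounded P t ⊕ bounded P (t + 1)) ⊕ (bounded P t ⊕ Unit) → bounded P (t + 1)
  | .inl (.inl S) => ⟨S.1, fun b hb => ⟨(S.2 b hb).1, (S.2 b hb).2.trans t.le_succ⟩⟩
  | .inl (.inr S) => ⟨S.1.addUnmarked (t + 1) t.succ_pos, fun b hb => by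
      rcases Multiset.mem_cons.1 hb with rfl | hb
      exacts [⟨hP, le_rfl⟩, S.2 b hb]⟩
  | .inr (.inl S) => ⟨S.1.addMarked (t + 1) (exists_mem_lt S.2), fun b hb => by
      rcases Multiset.mem_cons.1 hb with rfl | hb
      exacts [⟨hP, le_rfl⟩, ⟨(S.2 b hb).1, (S.2 b hb).2.trans t.le_succ⟩]⟩
  | .inr (.inr _) => ⟨single (t + 1) t.succ_pos, fun b hb => by
      rw [Multiset.mem_singleton.1 hb]; exact ⟨hP, le_rfl⟩⟩

/-- The entries separate most cases. A marked and an unmarked adjunction with equal entries are told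
apart by the mark on `t + 1`: the unmarked one would start from a content without `t + 1`, which
cannot mark it. -/
theorem boundedSuccMap_injective (P : ℕ → Prop) (t : ℕ) (hP : P (t + 1)) :
    Function.Injective (boundedSuccMap P t hP) := by
  rintro ((⟨S, hS⟩ | ⟨S, hS⟩) | (⟨S, hS⟩ | ⟨⟩)) ((⟨T, hT⟩ | ⟨T, hT⟩) | (⟨T, hT⟩ | ⟨⟩)) h <;>
    replace h := MarkedMultiset.ext_iff.1 (congrArg Subtype.val h) <;>
    simp only [boundedSuccMap, addUnmarked, addMarked, single] at h
  · simp [MarkedMultiset.ext_iff, h]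
  · exact absurd (h.1 ▸ Multiset.mem_cons_self _ _) (notMem_of_bounded hS)
  · exact absurd (h.1 ▸ Multiset.mem_cons_self _ _) (notMem_of_bounded hS)
  · exact absurd (h.1 ▸ Multiset.mem_singleton_self _) (notMem_of_bounded hS)
  · exact absurd (h.1 ▸ Multiset.mem_cons_self _ _) (notMem_of_bounded hT)
  · have := (Multiset.cons_inj_right _).1 h.1
    simp [MarkedMultiset.ext_iff, h, this]
  · have h1 := (Multiset.cons_inj_right _).1 h.1
    exact absurd (h1 ▸ (S.marked_spec (t + 1) (h.2 ▸ Finset.mem_insert_self _ _)).1)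
      (notMem_of_bounded hT)
  · exact absurd ((Multiset.cons_inj_right (t := 0) _).1 h.1) S.entries_ne
  · exact absurd (h.1 ▸ Multiset.mem_cons_self _ _) (notMem_of_bounded hT)
  · have h1 := (Multiset.cons_inj_right _).1 h.1
    exact absurd (h1 ▸ (T.marked_spec (t + 1) (h.2 ▸ Finset.mem_insert_self _ _)).1)
      (notMem_of_bounded hS)
  · have h1 := (Multiset.cons_inj_right _).1 h.1
    have h2 := congrArg (fun s => s.erase (t + 1)) h.2
    simp only [Finset.erase_insert (notMem_marked_of_bounded hS),
      Finset.erase_insert (notMem_marked_of_bounded hT)] at h2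
    simp [MarkedMultiset.ext_iff, h1, h2]
  · exact absurd ((Multiset.cons_inj_right (t := 0) _).1 h.1) S.entries_ne
  · exact absurd (h.1 ▸ Multiset.mem_singleton_self _) (notMem_of_bounded hT)
  · exact absurd ((Multiset.cons_inj_right (t := 0) _).1 h.1.symm) T.entries_ne
  · exact absurd ((Multiset.cons_inj_right (t := 0) _).1 h.1.symm) T.entries_ne
  · rfl

theorem boundedSuccMap_surjective (P : ℕ → Prop) (t : ℕ) (hP : P (t + 1)) :
    Function.Surjective (boundedSuccMap P t hP) := by
  rintro ⟨S, hS⟩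
  by_cases hv : t + 1 ∈ S.entries
  swap
  · refine ⟨.inl (.inl ⟨S, fun b hb => ⟨(hS b hb).1, ?_⟩⟩), rfl⟩
    have h1 := (hS b hb).2
    have h2 : b ≠ t + 1 := fun h => hv (h ▸ hb)
    omega
  obtain ⟨E, hE⟩ := Multiset.exists_cons_of_mem hv
  have hmem : ∀ a ∈ S.entries, a ≠ t + 1 → a ∈ E := by
    intro a ha hat
    rw [hE] at ha
    exact (Multiset.mem_cons.1 ha).resolve_left hat
  have hsub : ∀ a ∈ E, a ∈ S.entries := fun a ha => hE ▸ Multiset.mem_cons_of_mem ha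
  have hlt : ∀ a ∈ S.marked, ∃ b ∈ E, b < a := by
    intro a ha
    obtain ⟨h, b, hb, hba⟩ := S.marked_spec a ha
    have := (hS a h).2
    exact ⟨b, hmem b hb (by omega), hba⟩
  by_cases hE0 : E = 0
  · subst hE0
    refine ⟨.inr (.inr ()), Subtype.ext (MarkedMultiset.ext ?_ ?_)⟩
    · simp [boundedSuccMap, single, hE]
    · symm
      simp only [boundedSuccMap, single]
      refine Finset.eq_empty_of_forall_notMem fun a ha => ?_
      obtain ⟨b, hb, -⟩ := hlt a ha
      simp at hb
  -- Only the first copy can carry the mark. If another copy of `t + 1` remains in `E`, the removed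
  -- copy counts as unmarked and the mark stays; a marked copy is removed only when it is the sole
  -- one.
  by_cases hm : t + 1 ∈ S.marked ∧ t + 1 ∉ E
  · refine ⟨.inr (.inl ⟨⟨E, S.marked.erase (t + 1), hE0, fun a ha => S.entries_pos a (hsub a ha),
      fun a ha => ⟨hmem a (S.marked_spec a (Finset.mem_of_mem_erase ha)).1
        (Finset.ne_of_mem_erase ha), hlt a (Finset.mem_of_mem_erase ha)⟩⟩,
      fun b hb => ⟨(hS b (hsub b hb)).1, ?_⟩⟩), Subtype.ext (MarkedMultiset.ext ?_ ?_)⟩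
    · have h1 := (hS b (hsub b hb)).2
      have h2 : b ≠ t + 1 := fun h => hm.2 (h ▸ hb)
      omega
    · simp [boundedSuccMap, addMarked, hE]
    · simp [boundedSuccMap, addMarked, Finset.insert_erase hm.1]
  · refine ⟨.inl (.inr ⟨⟨E, S.marked, hE0, fun a ha => S.entries_pos a (hsub a ha),
      fun a ha => ⟨?_, hlt a ha⟩⟩, fun b hb => hS b (hsub b hb)⟩),
      Subtype.ext (MarkedMultiset.ext ?_ ?_)⟩
    · by_cases hat : a = t + 1
      · subst hat
        by_contra hc
        exact hm ⟨ha, hc⟩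
      · exact hmem a (S.marked_spec a ha).1 hat
    · simp [boundedSuccMap, addUnmarked, hE]
    · simp [boundedSuccMap, addUnmarked]

end MarkedMultiset

theorem cellWt_addUnmarked (i j : ℕ) (S : MarkedMultiset) (v : ℕ) (hv : 0 < v) :
    cellWt i j (S.addUnmarked v hv) = GSeries.α j * GSeries.x v * cellWt i j S := by
  have h1 := S.numUnmarked_pos
  have h2 : (S.addUnmarked v hv).numUnmarked - 1 = S.numUnmarked - 1 + 1 := by
    have h3 := (S.addUnmarked v hv).numUnmarked_pos
    have h4 : (S.addUnmarked v hv).numMarked = S.numMarked := rfl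
    have h5 : (S.addUnmarked v hv).entries.card = S.entries.card + 1 := Multiset.card_cons _ _
    omega
  rw [cellWt, cellWt, h2, show (S.addUnmarked v hv).numMarked = S.numMarked from rfl,
    show (S.addUnmarked v hv).entries = v ::ₘ S.entries from rfl, Multiset.map_cons,
    Multiset.prod_cons]
  ring

theorem cellWt_addMarked (i j : ℕ) (S : MarkedMultiset) (v : ℕ) (hv : ∃ b ∈ S.entries, b < v)
    (hvS : v ∉ S.marked) :
    cellWt i j (S.addMarked v hv) = -GSeries.β i * GSeries.x v * cellWt i j S := by
  have h1 := S.numUnmarked_pos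
  have h4 : (S.addMarked v hv).numMarked = S.numMarked + 1 := Finset.card_insert_of_notMem hvS
  have h2 : (S.addMarked v hv).numUnmarked = S.numUnmarked := by
    have h3 := (S.addMarked v hv).numUnmarked_pos
    have h5 : (S.addMarked v hv).entries.card = S.entries.card + 1 := Multiset.card_cons _ _
    omega
  rw [cellWt, cellWt, h2, h4,
    show (S.addMarked v hv).entries = v ::ₘ S.entries from rfl, Multiset.map_cons,
    Multiset.prod_cons]
  ring

/-- The generating function of the contents of one cell. -/
noncomputable def cellSeries (i j : ℕ) (P : ℕ → Prop) (w : ℕ) : GSeries :=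
  ∑' S : MarkedMultiset.bounded P w, cellWt i j S.1

theorem hasSum_cellSeries (i j : ℕ) (P : ℕ → Prop) (w : ℕ) :
    HasSum (fun S : MarkedMultiset.bounded P w => cellWt i j S.1) (cellSeries i j P w) :=
  (summable_cellWt i j w _ fun _ hS a ha => (hS a ha).2).hasSum

/-- The four cases of `boundedSuccMap` contribute `h_t`, `αx h_{t+1}`, `-βx h_t` and `x` to the
series `h_{t+1}`. -/
theorem cellSeries_succ (i j : ℕ) (P : ℕ → Prop) (t : ℕ) (hP : P (t + 1)) :
    (1 - GSeries.α j * GSeries.x (t + 1)) * cellSeries i j P (t + 1) =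
      (1 - GSeries.β i * GSeries.x (t + 1)) * cellSeries i j P t + GSeries.x (t + 1) := by
  let e := Equiv.ofBijective _ ⟨MarkedMultiset.boundedSuccMap_injective P t hP,
    MarkedMultiset.boundedSuccMap_surjective P t hP⟩
  have h := e.hasSum_iff.2 (hasSum_cellSeries i j P (t + 1))
  have h' : HasSum ((fun S : MarkedMultiset.bounded P (t + 1) => cellWt i j S.1) ∘ e)
      ((cellSeries i j P t + GSeries.α j * GSeries.x (t + 1) * cellSeries i j P (t + 1)) +
        (-GSeries.β i * GSeries.x (t + 1) * cellSeries i j P t + GSeries.x (t + 1))) := by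
    have hsum := fun w => hasSum_cellSeries i j P w
    refine HasSum.sum (HasSum.sum (hsum t) ?_) (HasSum.sum ?_ ?_)
    · refine ((hsum (t + 1)).mul_left _).congr_fun fun S => ?_
      exact cellWt_addUnmarked i j S.1 _ t.succ_pos
    · refine ((hsum t).mul_left _).congr_fun fun S => ?_
      exact cellWt_addMarked i j S.1 _ (MarkedMultiset.exists_mem_lt S.2) (MarkedMultiset.notMem_marked_of_bounded S.2)
    · have hx : cellWt i j (MarkedMultiset.single (t + 1) t.succ_pos) = GSeries.x (t + 1) := by
        simp [cellWt, MarkedMultiset.single, MarkedMultiset.numUnmarked, MarkedMultiset.numMarked]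
      rw [← hx]
      exact hasSum_unique _
  have := h.unique h'
  linear_combination this

/-! ### Removing a corner cell. -/

section Corner

variable {n : ℕ} {D : Finset (ℕ × ℕ)} {c : ℕ × ℕ}

/-- The restriction of a filling to the complement of the cell `c`. -/
def restrictErase (T : D → MarkedMultiset) (d : D.erase c) : MarkedMultiset :=
  T ⟨d.1, Finset.mem_of_mem_erase d.2⟩

/-- The extension of a filling by the content `S` of the cell `c`. -/
def extendErase (U : D.erase c → MarkedMultiset) (S : MarkedMultiset) (d : D) : MarkedMultiset :=
  if h : d.1 = c then S else U ⟨d.1, Finset.mem_erase.2 ⟨h, d.2⟩⟩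

theorem restrictErase_extendErase (U : D.erase c → MarkedMultiset) (S : MarkedMultiset) :
    restrictErase (extendErase U S) = U := by
  ext1 d
  simp [restrictErase, extendErase, Finset.ne_of_mem_erase d.2]

theorem extendErase_self (U : D.erase c → MarkedMultiset) (S : MarkedMultiset) (hc : c ∈ D) :
    extendErase U S ⟨c, hc⟩ = S := by
  simp [extendErase]

theorem extendErase_restrictErase (T : D → MarkedMultiset) (hc : c ∈ D) :
    extendErase (restrictErase (c := c) T) (T ⟨c, hc⟩) = T := by
  ext1 d
  unfold extendErase restrictErase
  split_ifs with h
  · congr 1; exact Subtype.ext h.symm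
  · rfl

theorem tableauWt_eq_mul (T : D → MarkedMultiset) (hc : c ∈ D) :
    tableauWt T = cellWt c.1 c.2 (T ⟨c, hc⟩) * tableauWt (restrictErase (c := c) T) := by
  classical
  rw [tableauWt_eq_prod_cellWt, tableauWt_eq_prod_cellWt,
    ← Finset.mul_prod_erase _ _ (Finset.mem_univ (⟨c, hc⟩ : D))]
  congr 1
  symm
  refine Finset.prod_bij (fun d _ => ⟨d.1, Finset.mem_of_mem_erase d.2⟩) ?_ ?_ ?_ ?_
  · intro d _
    refine Finset.mem_erase.2 ⟨fun h => Finset.ne_of_mem_erase d.2 (congrArg Subtype.val h),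
      Finset.mem_univ _⟩
  · intro d _ d' _ h
    exact Subtype.ext (congrArg (fun z : D => z.1) h)
  · intro d hd
    exact ⟨⟨d.1, Finset.mem_erase.2 ⟨fun h => Finset.ne_of_mem_erase hd (Subtype.ext h), d.2⟩⟩,
      Finset.mem_univ _, rfl⟩
  · intro d _
    rfl

/-- The condition on an entry `b` of a corner cell `c` in column `i` (counted from `0`) that is
imposed by the lower flag bound and the neighbouring cells. -/
def CornerLower (r : Fin n → ℕ) (i : Fin n) (U : D.erase c → MarkedMultiset) (b : ℕ) : Prop :=
  r i ≤ b ∧ ∀ d : D.erase c, (c = (d.1.1, d.1.2 + 1) → ∀ a ∈ (U d).entries, a ≤ b) ∧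
    (c = (d.1.1 + 1, d.1.2) → ∀ a ∈ (U d).entries, a < b)

theorem lt_of_mem_column {T : D → MarkedMultiset} (hT : IsMMSVT T) (hc : c ∈ D)
    (hcol : ∀ a, (a, c.2) ∈ D → a ≤ c.1 ∧ (a < c.1 → (a + 1, c.2) ∈ D)) {w : ℕ}
    (hw : ∀ b ∈ (T ⟨c, hc⟩).entries, b ≤ w) :
    ∀ k a : ℕ, ∀ h : (a, c.2) ∈ D, a + k + 1 = c.1 → ∀ b ∈ (T ⟨(a, c.2), h⟩).entries, b < w := by
  intro k
  induction k with
  | zero =>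
    intro a h hk b hb
    obtain ⟨b', hb'⟩ := Multiset.exists_mem_of_ne_zero (T ⟨c, hc⟩).entries_ne
    exact (hT.col ⟨(a, c.2), h⟩ ⟨c, hc⟩ (Prod.ext hk.symm rfl) b hb b' hb').trans_le (hw b' hb')
  | succ k ih =>
    intro a h hk b hb
    have h' := (hcol a h).2 (by omega)
    obtain ⟨b', hb'⟩ := Multiset.exists_mem_of_ne_zero (T ⟨_, h'⟩).entries_ne
    exact (hT.col ⟨(a, c.2), h⟩ ⟨_, h'⟩ rfl b hb b' hb').trans (ih (a + 1) h' (by omega) b' hb')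

/-- The cells above the corner are strictly below its entries, hence at most `t` whether the flag
`w` is `t` or `t + 1`. Both flagged sums are therefore indexed by the same fillings of the remaining
cells, with flag `t`. -/
theorem mem_MMSVTCol_iff {r s : Fin n → ℕ} {i : Fin n} {t w : ℕ} (T : D → MarkedMultiset)
    (hc : c ∈ D) (hci : c.2 = i + 1) (hright : (c.1, c.2 + 1) ∉ D)
    (hcol : ∀ a, (a, c.2) ∈ D → a ≤ c.1 ∧ (a < c.1 → (a + 1, c.2) ∈ D))
    (htw : t ≤ w) (hwt : w ≤ t + 1) :
    T ∈ MMSVTCol D r (Function.update s i w) ↔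
      restrictErase (c := c) T ∈ MMSVTCol (D.erase c) r (Function.update s i t) ∧
        T ⟨c, hc⟩ ∈ MarkedMultiset.bounded (CornerLower r i (restrictErase (c := c) T)) w := by
  have hi : ∀ k : Fin n, c.2 = (k : ℕ) + 1 → k = i := fun k hk => Fin.ext (by omega)
  constructor
  · rintro ⟨hT, hF⟩
    have hw : ∀ b ∈ (T ⟨c, hc⟩).entries, b ≤ w := fun b hb => by
      simpa using (hF ⟨c, hc⟩ i hci b hb).2
    refine ⟨⟨⟨fun d e h => hT.row _ _ h, fun d e h => hT.col _ _ h⟩, fun d k hk a ha => ?_⟩,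
      fun b hb => ⟨⟨(hF ⟨c, hc⟩ i hci b hb).1, fun d => ⟨fun h a ha => hT.row _ ⟨c, hc⟩ h a ha b hb,
        fun h a ha => hT.col _ ⟨c, hc⟩ h a ha b hb⟩⟩, hw b hb⟩⟩
    have h1 := hF _ k hk a ha
    by_cases hki : k = i
    · subst hki
      refine ⟨h1.1, ?_⟩
      rw [Function.update_self]
      obtain ⟨⟨d1, d2⟩, hd⟩ := d
      have hd2 : d2 = c.2 := by simp only at hk; omega
      subst hd2
      have hdD := Finset.mem_of_mem_erase hd
      have h2 : d1 ≠ c.1 := fun h => Finset.ne_of_mem_erase hd (Prod.ext h rfl)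
      have h3 := (hcol d1 hdD).1
      have := lt_of_mem_column hT hc hcol hw (c.1 - d1 - 1) d1 hdD (by omega) a ha
      omega
    · simpa [hki] using h1
  · rintro ⟨⟨hT, hF⟩, hb⟩
    refine ⟨⟨fun d e h a ha b hb' => ?_, fun d e h a ha b hb' => ?_⟩, fun d k hk a ha => ?_⟩
    · by_cases hd : d.1 = c
      · exact absurd (hd ▸ h ▸ e.2) hright
      · by_cases he : e.1 = c
        · obtain rfl : e = ⟨c, hc⟩ := Subtype.ext he
          exact ((hb b hb').1.2 ⟨d.1, Finset.mem_erase.2 ⟨hd, d.2⟩⟩).1 h a ha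
        · exact hT.row ⟨d.1, Finset.mem_erase.2 ⟨hd, d.2⟩⟩ ⟨e.1, Finset.mem_erase.2 ⟨he, e.2⟩⟩
            h a ha b hb'
    · by_cases hd : d.1 = c
      · have := (hcol (c.1 + 1) (hd ▸ h ▸ e.2)).1
        omega
      · by_cases he : e.1 = c
        · obtain rfl : e = ⟨c, hc⟩ := Subtype.ext he
          exact ((hb b hb').1.2 ⟨d.1, Finset.mem_erase.2 ⟨hd, d.2⟩⟩).2 h a ha
        · exact hT.col ⟨d.1, Finset.mem_erase.2 ⟨hd, d.2⟩⟩ ⟨e.1, Finset.mem_erase.2 ⟨he, e.2⟩⟩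
            h a ha b hb'
    · by_cases hd : d.1 = c
      · obtain rfl : d = ⟨c, hc⟩ := Subtype.ext hd
        obtain rfl := hi k hk
        rw [Function.update_self]
        exact ⟨(hb a ha).1.1, (hb a ha).2⟩
      · have h1 := hF ⟨d.1, Finset.mem_erase.2 ⟨hd, d.2⟩⟩ k hk a ha
        by_cases hki : k = i
        · subst hki
          rw [Function.update_self] at h1 ⊢
          exact ⟨h1.1, h1.2.trans htw⟩
        · simpa [hki] using h1

/-- Maximality of `t + 1` bounds the left neighbour weakly, and the lowered flag `t` bounds the
upper neighbour strictly. This supplies the hypothesis of `cellSeries_succ`. -/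
theorem cornerLower_succ {r s : Fin n → ℕ} {i : Fin n} {t : ℕ} {U : D.erase c → MarkedMultiset}
    (hU : U ∈ MMSVTCol (D.erase c) r (Function.update s i t)) (hci : c.2 = i + 1)
    (hD : ∀ d ∈ D, 0 < d.2) (hr : r i ≤ t + 1) (hs : ∀ k, s k ≤ t + 1) :
    CornerLower r i U (t + 1) := by
  refine ⟨hr, fun d => ⟨fun h a ha => ?_, fun h a ha => ?_⟩⟩
  · have h1 := hD d.1 (Finset.mem_of_mem_erase d.2)
    have h2 : c.2 = d.1.2 + 1 := congrArg Prod.snd h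
    have h3 : d.1.2 - 1 < n := by have := i.2; omega
    have h4 := (hU.2 d ⟨d.1.2 - 1, h3⟩ (by simp; omega) a ha).2
    rw [Function.update_of_ne (by rw [Ne, Fin.ext_iff]; simp; omega)] at h4
    exact h4.trans (hs _)
  · have h2 : c.2 = d.1.2 := (Prod.ext_iff.1 h).2
    have h4 := (hU.2 d i (by omega) a ha).2
    rw [Function.update_self] at h4
    omega

theorem hasSum_Gcol (hD : ∀ d ∈ D, ∃ k : Fin n, d.2 = k + 1) (r s : Fin n → ℕ) :
    HasSum (fun T : MMSVTCol D r s => tableauWt T.1) (Gcol D r s) := by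
  refine (summable_tableauWt (∑ k, s k) _ fun T hT d a ha => ?_).hasSum
  obtain ⟨k, hk⟩ := hD d.1 d.2
  exact (hT.2 d k hk a ha).2.trans (Finset.single_le_sum (fun _ _ => Nat.zero_le _)
    (Finset.mem_univ k))

theorem hasSum_cellSeries_mul {r s : Fin n → ℕ} {i : Fin n} {t w : ℕ}
    (hD : ∀ d ∈ D, ∃ k : Fin n, d.2 = k + 1)
    (hc : c ∈ D) (hci : c.2 = i + 1) (hright : (c.1, c.2 + 1) ∉ D)
    (hcol : ∀ a, (a, c.2) ∈ D → a ≤ c.1 ∧ (a < c.1 → (a + 1, c.2) ∈ D))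
    (htw : t ≤ w) (hwt : w ≤ t + 1) :
    HasSum (fun U : MMSVTCol (D.erase c) r (Function.update s i t) =>
      cellSeries c.1 c.2 (CornerLower r i U.1) w * tableauWt U.1)
      (Gcol D r (Function.update s i w)) := by
  have hiff := fun T => mem_MMSVTCol_iff (r := r) (s := s) T hc hci hright hcol htw hwt
  let e : (Σ U : MMSVTCol (D.erase c) r (Function.update s i t),
      MarkedMultiset.bounded (CornerLower r i U.1) w) ≃ MMSVTCol D r (Function.update s i w) :=
    { toFun := fun p => ⟨extendErase p.1.1 p.2.1, (hiff _).2 (by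
        rw [restrictErase_extendErase, extendErase_self]
        exact ⟨p.1.2, p.2.2⟩)⟩
      invFun := fun T => ⟨⟨restrictErase T.1, ((hiff _).1 T.2).1⟩, ⟨T.1 ⟨c, hc⟩, ((hiff _).1 T.2).2⟩⟩
      left_inv := by
        rintro ⟨⟨U, hU⟩, ⟨S, hS⟩⟩
        have h1 := restrictErase_extendErase U S
        have h2 := extendErase_self U S hc
        refine Sigma.ext (Subtype.ext h1) ?_
        simp only
        congr! 
      right_inv := fun T => Subtype.ext (extendErase_restrictErase T.1 hc) }
  refine HasSum.sigma (e.hasSum_iff.2 (hasSum_Gcol hD r (Function.update s i w))) fun U => ?_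
  refine ((hasSum_cellSeries c.1 c.2 (CornerLower r i U.1) w).mul_right (tableauWt U.1)).congr_fun
    fun S => ?_
  change tableauWt (extendErase U.1 S.1) = _
  rw [tableauWt_eq_mul _ hc, extendErase_self, restrictErase_extendErase]

/-- The one-cell recursion holds for each filling `U` of the other cells; multiplying by the weight
of `U` and summing gives the identity. -/
theorem Gcol_succ {r s : Fin n → ℕ} {i : Fin n} {t : ℕ}
    (hD : ∀ d ∈ D, ∃ k : Fin n, d.2 = k + 1)
    (hc : c ∈ D) (hci : c.2 = i + 1) (hright : (c.1, c.2 + 1) ∉ D)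
    (hcol : ∀ a, (a, c.2) ∈ D → a ≤ c.1 ∧ (a < c.1 → (a + 1, c.2) ∈ D))
    (hr : r i ≤ t + 1) (hsi : s i = t + 1) (hs : ∀ k, s k ≤ t + 1) :
    (1 - GSeries.α (i + 1) * GSeries.x (t + 1)) * Gcol D r s =
      (1 - GSeries.β c.1 * GSeries.x (t + 1)) * Gcol D r (Function.update s i t) +
        GSeries.x (t + 1) * Gcol (D.erase c) r (Function.update s i t) := by
  have h1 := hasSum_cellSeries_mul (r := r) (s := s) hD hc hci hright hcol (Nat.le_succ t) le_rfl
  have h0 := hasSum_cellSeries_mul (r := r) (s := s) hD hc hci hright hcol (le_refl t) t.le_succ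
  have hU := hasSum_Gcol (D := D.erase c) (fun d hd => hD d (Finset.mem_of_mem_erase hd)) r
    (Function.update s i t)
  rw [show Function.update s i (t + 1) = s by rw [← hsi, Function.update_eq_self]] at h1
  refine (h1.mul_left (1 - GSeries.α (i + 1) * GSeries.x (t + 1))).unique ?_
  refine ((h0.mul_left _).add (hU.mul_left _)).congr_fun fun U => ?_
  have := cellSeries_succ c.1 c.2 (CornerLower r i U.1) t (cornerLower_succ U.2 hci
    (fun d hd => by obtain ⟨k, hk⟩ := hD d hd; omega) hr hs)
  rw [hci] at this ⊢
  linear_combination tableauWt U.1 * this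

end Corner

theorem Gcol_congr {n : ℕ} {D : Finset (ℕ × ℕ)} {r s r' s' : Fin n → ℕ}
    (h : ∀ T : D → MarkedMultiset, IsMMSVT T → (IsColFlagged r s T ↔ IsColFlagged r' s' T)) :
    Gcol D r s = Gcol D r' s' := by
  have : MMSVTCol D r s = MMSVTCol D r' s' := Set.ext fun T => and_congr_right (h T)
  unfold Gcol
  rw [this]

theorem Gcol_empty {n : ℕ} (r s : Fin n → ℕ) : Gcol ∅ r s = 1 := by
  have hmem : ∀ T : (∅ : Finset (ℕ × ℕ)) → MarkedMultiset, T ∈ MMSVTCol ∅ r s := fun T =>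
    ⟨⟨fun c => absurd c.2 (Finset.notMem_empty _), fun c => absurd c.2 (Finset.notMem_empty _)⟩,
      fun c => absurd c.2 (Finset.notMem_empty _)⟩
  have : Unique (MMSVTCol ∅ r s) :=
    { default := ⟨fun c => absurd c.2 (Finset.notMem_empty _), hmem _⟩
      uniq := fun T => Subtype.ext (funext fun c => absurd c.2 (Finset.notMem_empty _)) }
  rw [Gcol, tsum_eq_single default fun T hT => absurd (Subsingleton.elim _ _) hT]
  exact Finset.prod_eq_one fun c => absurd c.2 (Finset.notMem_empty _)

/-- The skew shape `λ'/μ'`. -/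
def skewCells {n : ℕ} (lam mu : Fin n → ℕ) : Finset (ℕ × ℕ) :=
  transposeCells (youngCells lam) \ transposeCells (youngCells mu)

/-! ### Cells, flags and updates for the shape `λ'/μ'`. -/

section Skew

variable {n : ℕ} {lam mu r s : Fin n → ℕ}

theorem mem_youngCells {i j : ℕ} :
    (i, j) ∈ youngCells lam ↔ ∃ k : Fin n, i = k + 1 ∧ 1 ≤ j ∧ j ≤ lam k := by
  simp only [youngCells, Finset.mem_biUnion, Finset.mem_univ, true_and, Finset.mem_image,
    Finset.mem_Icc, Prod.mk.injEq]
  constructor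
  · rintro ⟨k, j, hj, rfl, rfl⟩
    exact ⟨k, rfl, hj⟩
  · rintro ⟨k, rfl, hj⟩
    exact ⟨k, j, hj, rfl, rfl⟩

theorem mem_transposeCells {D : Finset (ℕ × ℕ)} {i j : ℕ} :
    (i, j) ∈ transposeCells D ↔ (j, i) ∈ D := by
  simp [transposeCells]

theorem mem_skewCells {a b : ℕ} :
    (a, b) ∈ skewCells lam mu ↔ ∃ k : Fin n, b = k + 1 ∧ mu k < a ∧ a ≤ lam k := by
  simp only [skewCells, Finset.mem_sdiff, mem_transposeCells, mem_youngCells]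
  constructor
  · rintro ⟨⟨k, rfl, h1, h2⟩, h⟩
    exact ⟨k, rfl, by by_contra hc; exact h ⟨k, rfl, h1, not_lt.1 hc⟩, h2⟩
  · rintro ⟨k, rfl, h1, h2⟩
    refine ⟨⟨k, rfl, by omega, h2⟩, ?_⟩
    rintro ⟨k', hk, h3, h4⟩
    obtain rfl : k = k' := Fin.ext (by omega)
    omega

theorem mem_skewCells_col {a : ℕ} {i : Fin n} :
    (a, (i : ℕ) + 1) ∈ skewCells lam mu ↔ mu i < a ∧ a ≤ lam i := by
  rw [mem_skewCells]
  constructor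
  · rintro ⟨k, hk, h⟩
    obtain rfl : i = k := Fin.ext (by omega)
    exact h
  · exact fun h => ⟨i, rfl, h⟩

theorem exists_col_of_mem_skewCells (d : ℕ × ℕ) (hd : d ∈ skewCells lam mu) :
    ∃ k : Fin n, d.2 = k + 1 :=
  let ⟨k, hk, _⟩ := mem_skewCells.1 hd
  ⟨k, hk⟩

theorem skewCells_update {i : Fin n} {l : ℕ} (hl : lam i = l + 1) :
    skewCells (Function.update lam i l) mu = (skewCells lam mu).erase (l + 1, (i : ℕ) + 1) := by
  ext ⟨a, b⟩
  rw [Finset.mem_erase, mem_skewCells, mem_skewCells]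
  constructor
  · rintro ⟨k, rfl, h1, h2⟩
    by_cases hk : k = i
    · subst hk
      rw [Function.update_self] at h2
      exact ⟨by simp; omega, k, rfl, h1, by omega⟩
    · rw [Function.update_of_ne hk] at h2
      exact ⟨by simp [Fin.ext_iff] at hk ⊢; omega, k, rfl, h1, h2⟩
  · rintro ⟨hne, k, rfl, h1, h2⟩
    refine ⟨k, rfl, h1, ?_⟩
    by_cases hk : k = i
    · subst hk
      rw [Function.update_self]
      simp at hne
      omega
    · rwa [Function.update_of_ne hk]

theorem Gcol_skewCells_eq_zero {j : Fin n} (hj : mu j < lam j) (h : s j < r j) :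
    Gcol (skewCells lam mu) r s = 0 := by
  have : IsEmpty (MMSVTCol (skewCells lam mu) r s) := by
    refine ⟨fun T => ?_⟩
    have hc : (lam j, (j : ℕ) + 1) ∈ skewCells lam mu := mem_skewCells_col.2 ⟨hj, le_rfl⟩
    obtain ⟨a, ha⟩ := Multiset.exists_mem_of_ne_zero (T.1 ⟨_, hc⟩).entries_ne
    have := T.2.2 ⟨_, hc⟩ j rfl a ha
    omega
  exact tsum_empty

/-- The bottom cell of column `i` has a right neighbour with entries at most `t`, so it is itself
bounded by `t`, and strict increase bounds the cells above it. -/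
theorem Gcol_skewCells_update_of_blocked (hmu : Antitone mu) {i i' : Fin n} {t : ℕ}
    (hii : (i : ℕ) + 1 = i') (hi : mu i < lam i) (hlam : lam i = lam i') (ht : s i = t + 1)
    (ht' : s i' = t) :
    Gcol (skewCells lam mu) r s = Gcol (skewCells lam mu) r (Function.update s i t) := by
  refine Gcol_congr fun T hT => ⟨fun hF d k hk a ha => ?_, fun hF d k hk a ha => ?_⟩
  · by_cases hki : k = i
    swap
    · simpa [hki] using hF d k hk a ha
    subst hki
    refine ⟨(hF d k hk a ha).1, ?_⟩
    rw [Function.update_self]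
    have hc : (lam k, (k : ℕ) + 1) ∈ skewCells lam mu := mem_skewCells_col.2 ⟨hi, le_rfl⟩
    have hc' : (lam k, (i' : ℕ) + 1) ∈ skewCells lam mu :=
      mem_skewCells_col.2 ⟨(hmu (by rw [Fin.le_def]; omega)).trans_lt hi, hlam.le⟩
    have hw : ∀ b ∈ (T ⟨_, hc⟩).entries, b ≤ t := by
      intro b hb
      obtain ⟨b', hb'⟩ := Multiset.exists_mem_of_ne_zero (T ⟨_, hc'⟩).entries_ne
      rw [← ht']
      exact (hT.row ⟨_, hc⟩ ⟨_, hc'⟩ (by simp [hii]) b hb b' hb').trans (hF ⟨_, hc'⟩ i' rfl b' hb').2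
    obtain ⟨⟨d1, d2⟩, hd⟩ := d
    obtain rfl : d2 = (k : ℕ) + 1 := hk
    have hd' := mem_skewCells_col.1 hd
    rcases hd'.2.eq_or_lt with rfl | hlt
    · exact hw a ha
    · refine (lt_of_mem_column hT hc (fun b hb => ?_) hw (lam k - d1 - 1) d1 hd ?_ a ha).le
      · have hb := mem_skewCells_col.1 hb
        exact ⟨hb.2, fun h => mem_skewCells_col.2 ⟨by omega, h⟩⟩
      · simp only; omega
  · have h1 := hF d k hk a ha
    by_cases hki : k = i
    · subst hki
      rw [Function.update_self] at h1
      omega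
    · simpa [hki] using h1

theorem antitone_update {i : Fin n} {l : ℕ} (hlam : Antitone lam) (hl : l ≤ lam i)
    (h : ∀ j : Fin n, (i : ℕ) + 1 = j → lam j ≤ l) : Antitone (Function.update lam i l) := by
  intro a b hab
  by_cases hb : b = i
  · subst hb
    rw [Function.update_self]
    by_cases ha : a = b
    · subst ha; simp
    · rw [Function.update_of_ne ha]; exact hl.trans (hlam hab)
  · rw [Function.update_of_ne hb]
    by_cases ha : a = i
    · subst ha
      rw [Function.update_self]
      have hab' : (a : ℕ) < b := lt_of_le_of_ne hab fun h => hb (Fin.ext h.symm)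
      exact (hlam (show (⟨a + 1, by omega⟩ : Fin n) ≤ b by rw [Fin.le_def]; exact hab')).trans
        (h _ rfl)
    · rw [Function.update_of_ne ha]; exact hlam hab

/-- The hypothesis on the flags. -/
def FlagCompatible (lam mu r s : Fin n → ℕ) : Prop :=
  ∀ i j : Fin n, (i : ℕ) + 1 = (j : ℕ) → mu i < lam j →
    (r i : ℤ) - mu i ≤ (r j : ℤ) - mu j ∧ (s i : ℤ) - lam i ≤ (s j : ℤ) - lam j + 1

/-- Lowering `s_i` could only hurt the condition between `i - 1` and `i`. There `s_{i-1} ≤ t + 1`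
and `λ_i ≤ λ_{i-1}` suffice, which is why a maximal flag is lowered. -/
theorem FlagCompatible.update_right {i : Fin n} {t : ℕ} (h : FlagCompatible lam mu r s)
    (hlam : Antitone lam) (ht : s i = t + 1) (hs : ∀ k, s k ≤ t + 1) :
    FlagCompatible lam mu r (Function.update s i t) := by
  intro a b hab hlt
  obtain ⟨h1, h2⟩ := h a b hab hlt
  refine ⟨h1, ?_⟩
  have h3 := hs a
  have h4 : lam b ≤ lam a := hlam (by rw [Fin.le_def]; omega)
  have hne : a ≠ b := by rintro rfl; omega
  by_cases ha : a = i
  · subst ha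
    rw [Function.update_self, Function.update_of_ne hne.symm]
    omega
  · rw [Function.update_of_ne ha]
    by_cases hb : b = i
    · subst hb
      rw [Function.update_self]
      omega
    · rw [Function.update_of_ne hb]; exact h2

theorem FlagCompatible.update_both {i : Fin n} {l t : ℕ} (h : FlagCompatible lam mu r s)
    (hlam : Antitone lam) (hl : lam i = l + 1) (ht : s i = t + 1) (hs : ∀ k, s k ≤ t + 1) :
    FlagCompatible (Function.update lam i l) mu r (Function.update s i t) := by
  intro a b hab hlt
  have hne : a ≠ b := by rintro rfl; omega
  by_cases ha : a = i
  · subst ha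
    rw [Function.update_of_ne hne.symm] at hlt
    obtain ⟨h1, h2⟩ := h a b hab hlt
    simp only [Function.update_self, Function.update_of_ne hne.symm]
    exact ⟨h1, by omega⟩
  · by_cases hb : b = i
    · subst hb
      rw [Function.update_self] at hlt
      obtain ⟨h1, h2⟩ := h a b hab (by omega)
      simp only [Function.update_self, Function.update_of_ne hne]
      have h3 := hs a
      have h4 : lam b ≤ lam a := hlam (by rw [Fin.le_def]; omega)
      exact ⟨h1, by omega⟩
    · simp only [Function.update_of_ne ha, Function.update_of_ne hb] at hlt ⊢
      exact h a b hab hlt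

/-! ### The induction. -/

theorem isUnit_one_sub_mul_X (f : GSeries) (l : ℕ) : IsUnit (1 - f * GSeries.x l) :=
  MvPowerSeries.isUnit_iff_constantCoeff.2 (by simp)

/-- The induction is on the sum of all flags. Lower flags are counted too, since normalising an
empty column may lower only `r_j`. Upper flags may be zero, as the reductions produce such values.
-/
theorem colFactor_mul_det_jtMatrix (hmu : Antitone mu) (m : ℕ) :
    ∀ lam r s : Fin n → ℕ, ∑ i, (r i + s i) = m → Antitone lam → (∀ i, 0 < r i) →
      (∀ i, mu i ≤ lam i) → FlagCompatible lam mu r s →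
      Gcol (skewCells lam mu) r s = colFactor r s * (jtMatrix lam mu r s).det := by
  induction m using Nat.strong_induction_on with
  | _ m ih =>
  intro lam r s hm hlam hr hsub hflag
  have hsum : ∀ (i : Fin n) (t : ℕ), s i = t + 1 →
      ∑ k, (r k + Function.update s i t k) < m := by
    intro i t ht
    rw [← hm]
    refine Finset.sum_lt_sum (fun k _ => ?_) ⟨i, Finset.mem_univ i, by simp [ht]⟩
    by_cases hk : k = i
    · subst hk; simp [ht]
    · simp [hk]
  by_cases hempty : ∃ j, lam j = mu j ∧ ¬(r j = 1 ∧ s j = 0)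
  · -- normalise the flags of an empty column
    obtain ⟨j, hj, hrs⟩ := hempty
    have hrj := hr j
    -- The values `r_j = 1`, `s_j = 0` are the smallest allowed. They ensure later that an empty
    -- column never attains the positive maximum of `s` and that `r_j ≤ t + 1`.
    rw [colFactor_mul_det_congr hlam hmu hj (r' := Function.update r j 1)
      (s' := Function.update s j 0) (fun i hi => by simp [hi]) (fun i hi => by simp [hi]),
      ← ih _ ?_ lam _ _ rfl hlam ?_ hsub ?_]
    · refine Gcol_congr fun T _ => forall_congr' fun d => forall_congr' fun k => forall_congr' fun hk => ?_
      have hkj : k ≠ j := by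
        rintro rfl
        obtain ⟨k', hk', h1, h2⟩ := mem_skewCells.1 (show (d.1.1, d.1.2) ∈ skewCells lam mu from d.2)
        obtain rfl : k = k' := Fin.ext (by omega)
        omega
      simp [hkj]
    · rw [← hm]
      refine Finset.sum_lt_sum (fun k _ => ?_) ⟨j, Finset.mem_univ j, by simp; omega⟩
      by_cases hk : k = j
      · subst hk; simp; omega
      · simp [hk]
    · intro i
      by_cases hi : i = j
      · subst hi; simp
      · simpa [hi] using hr i
    · intro a b hab hlt
      have hba : lam b ≤ lam a := hlam (by rw [Fin.le_def]; omega)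
      -- An empty column occurs in no flag condition: `μ_a < λ_b` makes both columns `a` and `b`
      -- nonempty.
      have ha : a ≠ j := by rintro rfl; omega
      have hb : b ≠ j := by
        rintro rfl
        have : mu b ≤ mu a := hmu (by rw [Fin.le_def]; omega)
        omega
      simpa [ha, hb] using hflag a b hab hlt
  push Not at hempty
  by_cases hall : lam = mu
  · subst hall
    rw [colFactor_mul_det_of_eq hlam, ← Gcol_empty r s]
    congr 1
    exact Finset.sdiff_self _
  have hlt : ∀ j, lam j ≠ mu j → mu j < lam j := fun j hj => lt_of_le_of_ne (hsub j) hj.symm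
  obtain ⟨j₀, hj₀⟩ := Function.ne_iff.1 hall
  by_cases hbig : ∃ j, lam j ≠ mu j ∧ ∀ i, s i < r j
  · obtain ⟨j, hj, hrs⟩ := hbig
    rw [Gcol_skewCells_eq_zero (hlt j hj) (hrs j),
      det_jtMatrix_eq_zero hlam hmu (fun i j h h' => (hflag i j h h').1) (hlt j hj) hrs, mul_zero]
  push Not at hbig
  -- the rightmost column whose upper flag bound is maximal
  obtain ⟨i₀, -, hi₀⟩ := Finset.exists_max_image Finset.univ s ⟨j₀, Finset.mem_univ _⟩
  obtain ⟨i, hi, himax⟩ := Finset.exists_max_image (Finset.univ.filter fun k => s k = s i₀) id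
    ⟨i₀, by simp⟩
  have hsi : s i = s i₀ := (Finset.mem_filter.1 hi).2
  have hmax : ∀ k, s k ≤ s i := fun k => hsi ▸ hi₀ k (Finset.mem_univ k)
  have hright : ∀ k, i < k → s k < s i := by
    intro k hk
    refine lt_of_le_of_ne (hmax k) fun h => ?_
    exact absurd (himax k (by simp [h, hsi])) (not_le.2 hk)
  have hpos : 0 < s i := by
    obtain ⟨k, hk⟩ := hbig j₀ hj₀
    exact (hr j₀).trans_le (hk.trans (hmax k))
  obtain ⟨t, ht⟩ := Nat.exists_eq_add_one.2 hpos
  rw [ht] at hmax hright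
  have hrt : ∀ j, r j ≤ t + 1 := by
    intro j
    by_cases hj : lam j = mu j
    · rw [(hempty j hj).1]; omega
    · obtain ⟨k, hk⟩ := hbig j hj
      exact hk.trans (hmax k)
  have hmi : mu i < lam i := hlt i fun h => by have := (hempty i h).2; omega
  have hfac := colFactor_update (s' := Function.update s i t) ht (by simp)
    (fun k hk => by simp [hk]) (hrt i)
  have ih1 := ih _ (hsum i t ht) lam r _ rfl hlam hr hsub (hflag.update_right hlam ht hmax)
  by_cases hblock : ∃ i' : Fin n, (i : ℕ) + 1 = i' ∧ lam i = lam i'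
  · obtain ⟨i', hii, hl⟩ := hblock
    -- The flag condition gives `s_{i'} ≥ t`, and the choice of the rightmost maximum gives `s_{i'}
    -- < t + 1`.
    have ht' : s i' = t := by
      have h1 := (hflag i i' hii (hl ▸ hmi)).2
      have h2 := hright i' (by rw [Fin.lt_def]; omega)
      omega
    rw [Gcol_skewCells_update_of_blocked hmu hii hmi hl ht ht', ih1,
      det_jtMatrix_succ_of_blocked hii hl ht ht' hrt, ← hfac]
    ring
  · push Not at hblock
    obtain ⟨l, hl⟩ := Nat.exists_eq_add_one.2 (Nat.zero_lt_of_lt hmi)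
    have hnext : ∀ j : Fin n, (i : ℕ) + 1 = j → lam j ≤ l := by
      intro j hj
      have h1 := hblock j hj
      have h2 : lam j ≤ lam i := hlam (by rw [Fin.le_def]; omega)
      omega
    have ih2 := ih _ (hsum i t ht) (Function.update lam i l) r _ rfl
      (antitone_update hlam (by omega) hnext) hr (fun k => by
        by_cases hk : k = i
        · subst hk; simp; omega
        · simpa [hk] using hsub k) (hflag.update_both hlam hl ht hmax)
    rw [skewCells_update hl] at ih2
    have hG := Gcol_succ (D := skewCells lam mu) (c := (l + 1, (i : ℕ) + 1)) (r := r)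
      exists_col_of_mem_skewCells (mem_skewCells_col.2 ⟨hl ▸ hmi, hl.ge⟩) rfl ?_ ?_ (hrt i) ht hmax
    · rw [ih1, ih2, ← hfac] at hG
      -- Both sides satisfy the recursion only after multiplication by `1 - αx`, a unit of the power
      -- series ring.
      refine (isUnit_one_sub_mul_X (GSeries.α (i + 1)) (t + 1)).mul_left_cancel ?_
      rw [hG, det_jtMatrix_succ hl ht hrt]
      ring
    · intro h
      obtain ⟨k, hk, h1, h2⟩ := mem_skewCells.1 h
      have := hnext k (by omega)
      omega
    · intro a ha
      have ha := mem_skewCells_col.1 ha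
      simp only
      exact ⟨by omega, fun h => mem_skewCells_col.2 ⟨by omega, by omega⟩⟩

end Skew

/-- Jacobi-Trudi-type formula for column-flagged refined canonical stable Grothendieck polynomials
of shape `λ'/μ'`. The index `i : Fin n` stands for the index `i + 1 ∈ {1, …, n}`. The first part
says that the sum that defines the left-hand side converges as a formal power series. -/
theorem theorem3p4 (n : ℕ) (lam mu r s : Fin n → ℕ)
    (hlam : Antitone lam) (hmu : Antitone mu)
    (hr : ∀ i, 0 < r i) (hs : ∀ i, 0 < s i)
    (hsub : youngCells mu ⊆ youngCells lam)
    (hflag : ∀ i j : Fin n, (i : ℕ) + 1 = (j : ℕ) → mu i < lam j →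
      (r i : ℤ) - mu i ≤ (r j : ℤ) - mu j ∧ (s i : ℤ) - lam i ≤ (s j : ℤ) - lam j + 1) :
    Summable (fun T : MMSVTCol
        (transposeCells (youngCells lam) \ transposeCells (youngCells mu)) r s => tableauWt T.1) ∧
    Gcol (transposeCells (youngCells lam) \ transposeCells (youngCells mu)) r s =
      colFactor r s *
        (Matrix.of fun i j : Fin n =>
          eOminus ((lam i : ℤ) - mu j - ((i : ℕ) + 1) + ((j : ℕ) + 1))
            (Alphabet.X (r j) (s i))
            (Alphabet.A (i : ℕ) - Alphabet.A ((j : ℕ) + 1)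
              - Alphabet.B (lam i) + Alphabet.B (mu j))).det := by
  refine ⟨(hasSum_Gcol exists_col_of_mem_skewCells r s).summable,
    colFactor_mul_det_jtMatrix hmu _ lam r s rfl hlam hr (fun i => ?_) hflag⟩
  rcases Nat.eq_zero_or_pos (mu i) with h | h
  · omega
  · obtain ⟨k, hk, -, hle⟩ := mem_youngCells.1 (hsub (mem_youngCells.2 ⟨i, rfl, h, le_rfl⟩))
    obtain rfl : i = k := Fin.ext (by omega)
    exact hle
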